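/- Let $0<q<1$, and write $(a;q)_n=\prod_{j=0}^{n-1}(1-aq^j)$, $(a;q)_\infty=\prod_{j\ge 0}(1-aq^j)$, $(a_1,\dots,a_m;q)_n=\prod_{i=1}^m (a_i;q)_n$ for $n\in\{0,1,2,\dots\}\cup\{\infty\}$, and $${}_3\phi_2\Big[\begin{array}{c} a,\ b,\ c\\ d,\ e\end{array};\ q,\ z\Big]=\sum_{k=0}^\infty \frac{(a,b,c;q)_k}{(q,d,e;q)_k}\,z^k .$$ Let $\alpha\in\mathbb{R}$, $\beta>0$, $\xi<0$ with $\alpha\xi\notin\{q^{-n}:n=0,1,2,\dots\}$ (so that the series below has no zero denominators), and let $u\in\mathbb{C}$ with $\mathrm{Re}\,u<0$. Then $$\frac{(\alpha u,\alpha/u;q)_\infty}{(\beta u,\beta/u;q)_\infty}=\frac{(\alpha\xi,\alpha/\xi;q)_\infty}{(\beta\xi,\beta/\xi;q)_\infty}\;{}_3\phi_2\Big[\begin{array}{c}\alpha/\beta,\ \xi u,\ \xi/u\\ \alpha\xi,\ q\xi/\beta\end{array};\ q,\ q\Big]+\frac{1}{4\pi i}\int_{-i\infty}^{i\infty}\frac{(\alpha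 v,\alpha/v,\xi u,\xi/u;q)_\infty}{(\beta v,\beta/v,\xi v,\xi/v;q)_\infty}\,\frac{(1-v^2)\,u}{(u-v)(uv-1)\,v}\,dv,$$ where the series and the integral (along the imaginary axis, upwards) both converge absolutely. -/

import Mathlib

namespace QSeries

/-- The finite `q`-shifted factorial `(a; q)_n = ∏_{j < n} (1 - a q^j)`. -/
noncomputable def qPoch (a q : ℂ) (n : ℕ) : ℂ :=
  ∏ j ∈ Finset.range n, (1 - a * q ^ j)

/-- The infinite `q`-shifted factorial `(a; q)_∞ = ∏_{j ≥ 0} (1 - a q^j)`, for `|q| < 1`. -/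
noncomputable def qPochInf (a q : ℂ) : ℂ :=
  ∏' j : ℕ, (1 - a * q ^ j)

/-- The product defining `(a; q)_∞` converges for `|q| < 1`. -/
theorem multipliable_qPochInf (a : ℂ) {q : ℂ} (hq : ‖q‖ < 1) :
    Multipliable fun j : ℕ => 1 - a * q ^ j := by
  have h : Summable fun j : ℕ => ‖-(a * q ^ j)‖ := by
    simpa [norm_mul, norm_pow] using
      (summable_geometric_of_lt_one (norm_nonneg q) hq).mul_left ‖a‖
  simpa [sub_eq_add_neg] using multipliable_one_add_of_summable h

/-- The `k`-th term `(a, b, c; q)_k / (q, d, e; q)_k * z^k` of the basic hypergeometric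
series `₃φ₂`. -/
noncomputable def phi32Term (a b c d e q z : ℂ) (k : ℕ) : ℂ :=
  (qPoch a q k * qPoch b q k * qPoch c q k) /
    (qPoch q q k * qPoch d q k * qPoch e q k) * z ^ k

/-- The basic hypergeometric series `₃φ₂[a, b, c; d, e; q, z]`. -/
noncomputable def phi32 (a b c d e q z : ℂ) : ℂ :=
  ∑' k : ℕ, phi32Term a b c d e q z k

/-- Absolute convergence of the contour integral of `F` along the imaginary axis. -/
def IntegrableOnImagAxis (F : ℂ → ℂ) : Prop :=
  MeasureTheory.Integrable fun s : ℝ => F (s * Complex.I)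

/-- The contour integral `∫_{-i∞}^{i∞} F(v) dv`, parametrized by `v = i s`, `s ∈ ℝ`. -/
noncomputable def imagAxisIntegral (F : ℂ → ℂ) : ℂ :=
  ∫ s : ℝ, F (s * Complex.I) * Complex.I

/-- The integrand
`(α v, α/v, ξ u, ξ/u; q)_∞ / (β v, β/v, ξ v, ξ/v; q)_∞ * (1 - v²) u / ((u - v) (u v - 1) v)`. -/
noncomputable def remainderIntegrand (q α β ξ u v : ℂ) : ℂ :=
  (qPochInf (α * v) q * qPochInf (α / v) q * qPochInf (ξ * u) q * qPochInf (ξ / u) q) /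
    (qPochInf (β * v) q * qPochInf (β / v) q * qPochInf (ξ * v) q * qPochInf (ξ / v) q) *
    (((1 - v ^ 2) * u) / ((u - v) * (u * v - 1) * v))

end QSeries

/-!
In the variable `x = v + 1/v` the products `(a v, a/v; q)_∞` become entire functions `F_a(x)`, and
`v ↦ x` preserves the left half-plane. For real `α` and `β > 0` the quotient `F_α / F_β` is
analytic on `Re x < 0`, continuous up to the boundary and of polynomial growth there. The partial
sums of the `₃φ₂` series are its Newton interpolation polynomials at the nodes
`x_j = ξ q^j + 1/(ξ q^j)`: both sides obey the same recurrence under `ξ ↦ ξ q`. Hermite's formula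
writes the interpolation error as a Cauchy integral over the imaginary axis (when some nodes
coincide, perturb `ξ` and pass to the limit), and dominated convergence lets the number of nodes
tend to infinity. Finally `v = i s` corresponds to `x = i (s - 1/s)`, which runs through the
imaginary axis twice; this turns `1/(2πi)` into `1/(4πi)`.
-/

open Complex Filter Topology MeasureTheory Bornology

section InfiniteProduct

lemma differentiable_tprod_one_add {f : ℕ → ℂ → ℂ} (hf : ∀ j, Differentiable ℂ (f j))
    (hbound : ∀ R : ℝ, ∃ b : ℕ → ℝ, Summable b ∧ ∀ j z, ‖z‖ < R → ‖f j z‖ ≤ b j) :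
    Differentiable ℂ fun z => ∏' j, (1 + f j z) := by
  intro z₀
  obtain ⟨b, hb, hfb⟩ := hbound (‖z₀‖ + 1)
  have hprod : HasProdLocallyUniformlyOn (fun j z => 1 + f j z) (fun z => ∏' j, (1 + f j z))
      (Metric.ball 0 (‖z₀‖ + 1)) :=
    hb.hasProdLocallyUniformlyOn_nat_one_add Metric.isOpen_ball
      (.of_forall fun j z hz => hfb j z (by simpa using hz)) fun j => (hf j).continuous.continuousOn
  have hdiff : DifferentiableOn ℂ (fun z => ∏' j, (1 + f j z)) (Metric.ball 0 (‖z₀‖ + 1)) :=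
    hprod.differentiableOn (.of_forall fun s => by
      simpa only [Finset.prod_fn] using
        DifferentiableOn.finsetProd fun j _ => ((hf j).const_add 1).differentiableOn)
      Metric.isOpen_ball
  exact hdiff.differentiableAt (Metric.isOpen_ball.mem_nhds (by simp))

end InfiniteProduct

section DominatedConvergence

lemma tendsto_integral_div_of_norm_le {X ι 𝕜 : Type*} [MeasurableSpace X] {μ : Measure X}
    [RCLike 𝕜] {l : Filter ι} [l.NeBot] [l.IsCountablyGenerated] {f D₀ D : X → 𝕜} {E : ι → X → 𝕜}
    (hint₀ : Integrable (fun y => f y / D₀ y) μ) (hD₀ : ∀ y, D₀ y ≠ 0)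
    (hmeas : ∀ᶠ i in l, AEStronglyMeasurable (fun y => f y / E i y) μ)
    (hle : ∀ᶠ i in l, ∀ y, ‖D₀ y‖ ≤ ‖E i y‖) (hlim : ∀ y, Tendsto (E · y) l (𝓝 (D y))) :
    Integrable (fun y => f y / D y) μ ∧
      Tendsto (fun i => ∫ y, f y / E i y ∂μ) l (𝓝 (∫ y, f y / D y ∂μ)) := by
  have hbound {z : 𝕜} {y : X} (hz : ‖D₀ y‖ ≤ ‖z‖) : ‖f y / z‖ ≤ ‖f y / D₀ y‖ := by
    rw [norm_div, norm_div]
    exact div_le_div_of_nonneg_left (norm_nonneg _) (norm_pos_iff.2 (hD₀ y)) hz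
  have hDle (y : X) : ‖D₀ y‖ ≤ ‖D y‖ := ge_of_tendsto (hlim y).norm (hle.mono fun i hi => hi y)
  have hquot (y : X) : Tendsto (fun i => f y / E i y) l (𝓝 (f y / D y)) :=
    tendsto_const_nhds.div (hlim y) (norm_pos_iff.1 ((norm_pos_iff.2 (hD₀ y)).trans_le (hDle y)))
  refine ⟨?_, tendsto_integral_filter_of_dominated_convergence _ hmeas
    (hle.mono fun i hi => .of_forall fun y => hbound (hi y)) hint₀.norm (.of_forall hquot)⟩
  obtain ⟨φ, hφ⟩ := exists_seq_tendsto l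
  obtain ⟨n, hn⟩ := eventually_atTop.1 (hφ.eventually hmeas)
  refine hint₀.mono (aestronglyMeasurable_of_tendsto_ae atTop
    (f := fun k y => f y / E (φ (k + n)) y) (fun k => hn _ (Nat.le_add_left n k))
    (.of_forall fun y => ?_)) (.of_forall fun y => hbound (hDle y))
  exact (hquot y).comp (hφ.comp (tendsto_add_atTop_nat n))

end DominatedConvergence

section Boole

open Set

lemma hasDerivAt_sub_inv {s : ℝ} (hs : s ≠ 0) :
    HasDerivAt (fun s : ℝ => s - s⁻¹) (1 + (s ^ 2)⁻¹) s :=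
  ((hasDerivAt_id' s).sub (hasDerivAt_inv hs)).congr_deriv (by ring)

lemma strictMonoOn_sub_inv : StrictMonoOn (fun s : ℝ => s - s⁻¹) (Ioi 0) := fun _ ha _ _ hab =>
  sub_lt_sub hab (inv_strictAnti₀ ha hab)

lemma image_sub_inv_Ioi : (fun s : ℝ => s - s⁻¹) '' Ioi 0 = univ := by
  refine eq_univ_of_forall fun y => ?_
  have hsq : √(y ^ 2 + 4) ^ 2 = y ^ 2 + 4 := Real.sq_sqrt (by positivity)
  have hpos : 0 < y + √(y ^ 2 + 4) := by
    have : |y| < √(y ^ 2 + 4) := Real.lt_sqrt_of_sq_lt (by rw [sq_abs]; linarith)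
    linarith [neg_abs_le y]
  refine ⟨(y + √(y ^ 2 + 4)) / 2, half_pos hpos, ?_⟩
  simp only
  field_simp
  linear_combination hsq

variable {E : Type*} [NormedAddCommGroup E] [NormedSpace ℝ E] {h : ℝ → E}

lemma abs_one_add_inv_sq (s : ℝ) : |1 + (s ^ 2)⁻¹| = 1 + (s ^ 2)⁻¹ := abs_of_pos (by positivity)

lemma integrableOn_Ioi_comp_sub_inv (hh : Integrable h) :
    IntegrableOn (fun s : ℝ => (1 + (s ^ 2)⁻¹) • h (s - s⁻¹)) (Ioi 0) := by
  have := integrableOn_image_iff_integrableOn_abs_deriv_smul measurableSet_Ioi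
    (fun s hs => (hasDerivAt_sub_inv (ne_of_gt hs)).hasDerivWithinAt) strictMonoOn_sub_inv.injOn h
  simpa only [abs_one_add_inv_sq] using this.1 hh.integrableOn

lemma integral_Ioi_comp_sub_inv (h : ℝ → E) :
    ∫ s in Ioi (0 : ℝ), (1 + (s ^ 2)⁻¹) • h (s - s⁻¹) = ∫ y, h y := by
  have := integral_image_eq_integral_abs_deriv_smul measurableSet_Ioi
    (fun s hs => (hasDerivAt_sub_inv (ne_of_gt hs)).hasDerivWithinAt) strictMonoOn_sub_inv.injOn h
  simpa only [image_sub_inv_Ioi, setIntegral_univ, abs_one_add_inv_sq] using this.symm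

lemma comp_neg_sub_inv (h : ℝ → E) (s : ℝ) :
    (1 + ((-s) ^ 2)⁻¹) • h (-s - (-s)⁻¹) = (1 + (s ^ 2)⁻¹) • h (-(s - s⁻¹)) := by
  rw [neg_sq, inv_neg, neg_sub_neg, neg_sub]

theorem integrable_comp_sub_inv (hh : Integrable h) :
    Integrable fun s : ℝ => (1 + (s ^ 2)⁻¹) • h (s - s⁻¹) := by
  have hIoi := integrableOn_Ioi_comp_sub_inv hh.comp_neg
  simp only [← comp_neg_sub_inv] at hIoi
  rw [← integrableOn_univ, ← Iic_union_Ioi (a := (0 : ℝ)), integrableOn_union,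
    integrableOn_Iic_iff_integrableOn_Iio]
  refine ⟨?_, integrableOn_Ioi_comp_sub_inv hh⟩
  rw [← (Measure.measurePreserving_neg volume).integrableOn_comp_preimage
    (MeasurableEquiv.neg ℝ).measurableEmbedding]
  simpa only [neg_Iio, neg_zero, Set.neg_preimage, Function.comp_def] using hIoi

theorem integral_comp_sub_inv (hh : Integrable h) :
    ∫ s : ℝ, (1 + (s ^ 2)⁻¹) • h (s - s⁻¹) = (2 : ℝ) • ∫ y, h y := by
  rw [← intervalIntegral.integral_Iic_add_Ioi (b := 0) (integrable_comp_sub_inv hh).integrableOn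
    (integrable_comp_sub_inv hh).integrableOn, ← neg_zero, ← integral_comp_neg_Ioi, neg_zero]
  simp only [comp_neg_sub_inv]
  rw [integral_Ioi_comp_sub_inv fun y => h (-y), integral_Ioi_comp_sub_inv,
    integral_neg_eq_self, two_smul]

end Boole

section Cayley

/-- The Cayley transform, an involution exchanging the open unit disc with the left half-plane and
the unit circle with the imaginary axis (the point `1` corresponds to `∞`). -/
noncomputable def cayley (z : ℂ) : ℂ := (z + 1) / (z - 1)

lemma cayley_eq_one_add (z : ℂ) (hz : z ≠ 1) : cayley z = 1 + 2 * (z - 1)⁻¹ := by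
  have : z - 1 ≠ 0 := sub_ne_zero.2 hz
  rw [cayley]
  field_simp
  ring

lemma cayley_ne_one (z : ℂ) : cayley z ≠ 1 := by
  rcases eq_or_ne z 1 with rfl | hz
  · simp [cayley]
  · simpa [cayley_eq_one_add z hz, sub_eq_zero] using hz

lemma cayley_cayley {z : ℂ} (hz : z ≠ 1) : cayley (cayley z) = z := by
  have : z - 1 ≠ 0 := sub_ne_zero.2 hz
  rw [cayley_eq_one_add _ (cayley_ne_one z), cayley_eq_one_add z hz]
  simp [field]

lemma cayley_re (z : ℂ) : (cayley z).re = (‖z‖ ^ 2 - 1) / ‖z - 1‖ ^ 2 := by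
  rw [cayley, div_re, ← add_div, Complex.sq_norm, Complex.sq_norm]
  congr 1
  simp only [normSq_apply, add_re, sub_re, add_im, sub_im, one_re, one_im]
  ring

lemma norm_sub_one_pos {z : ℂ} (hz : ‖z‖ < 1) : 0 < ‖z - 1‖ :=
  norm_pos_iff.2 <| sub_ne_zero.2 <| by rintro rfl; simp at hz

lemma cayley_re_neg {z : ℂ} (hz : ‖z‖ < 1) : (cayley z).re < 0 := by
  rw [cayley_re]
  exact div_neg_of_neg_of_pos (by nlinarith [norm_nonneg z]) (pow_pos (norm_sub_one_pos hz) 2)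

lemma cayley_re_nonpos {z : ℂ} (hz : ‖z‖ ≤ 1) : (cayley z).re ≤ 0 := by
  rw [cayley_re]
  exact div_nonpos_of_nonpos_of_nonneg (by nlinarith [norm_nonneg z]) (by positivity)

lemma norm_cayley_lt_one {z : ℂ} (hz : z.re < 0) : ‖cayley z‖ < 1 := by
  have hz1 : z ≠ 1 := by rintro rfl; norm_num at hz
  rw [← cayley_cayley hz1, cayley_re, div_neg_iff] at hz
  rcases hz with ⟨-, h⟩ | ⟨h, -⟩
  · exact absurd h (sq_nonneg _).not_gt
  · nlinarith [norm_nonneg (cayley z)]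

lemma tendsto_cayley_cobounded : Tendsto cayley (𝓝[≠] 1) (cobounded ℂ) := by
  have h : Tendsto (fun z : ℂ => z - 1) (𝓝[≠] 1) (𝓝[≠] 0) :=
    tendsto_nhdsWithin_iff.2 ⟨tendsto_nhdsWithin_of_tendsto_nhds <|
      (continuous_sub_right (1 : ℂ)).tendsto' 1 0 (sub_self _),
      by filter_upwards [self_mem_nhdsWithin] with z hz using sub_ne_zero.2 hz⟩
  refine ((tendsto_const_add_cobounded (1 : ℂ)).comp <|
    (tendsto_mul_left_cobounded two_ne_zero).comp (tendsto_inv₀_nhdsNE_zero.comp h)).congr' ?_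
  filter_upwards [self_mem_nhdsWithin] with z hz using (cayley_eq_one_add z hz).symm

lemma cayley_sub_cayley {z w : ℂ} (hz : z ≠ 1) (hw : w ≠ 1) :
    cayley z - cayley w = -2 * (z - w) / ((z - 1) * (w - 1)) := by
  have h₁ : z - 1 ≠ 0 := sub_ne_zero.2 hz
  have h₂ : w - 1 ≠ 0 := sub_ne_zero.2 hw
  rw [cayley, cayley]
  field_simp
  ring

lemma differentiableOn_cayley : DifferentiableOn ℂ cayley {1}ᶜ := by
  intro z hz
  have hz' : z - 1 ≠ 0 := sub_ne_zero.2 hz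
  unfold cayley
  fun_prop (disch := assumption)

lemma ofReal_mul_I_ne_one (s : ℝ) : (s : ℂ) * I ≠ 1 := fun h => by simpa using congrArg re h

lemma circleMap_pi_add_two_arctan (s : ℝ) :
    circleMap 0 1 (Real.pi + 2 * Real.arctan s) = cayley (s * I) := by
  have hs : (0 : ℝ) < 1 + s ^ 2 := by positivity
  have hexp : exp (Real.arctan s * I) = (1 + s * I) / (√(1 + s ^ 2) : ℝ) := by
    rw [exp_mul_I, ← ofReal_cos, ← ofReal_sin, Real.cos_arctan, Real.sin_arctan]
    push_cast
    ring
  have hsqrt : ((√(1 + s ^ 2) : ℝ) : ℂ) ^ 2 = (1 + s * I) * (1 - s * I) := by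
    rw [← ofReal_pow, Real.sq_sqrt hs.le]
    push_cast
    linear_combination ((s : ℂ) ^ 2) * I_sq
  have hadd : (1 : ℂ) + s * I ≠ 0 := fun h => by simpa using congrArg re h
  have hangle : ((Real.pi + 2 * Real.arctan s : ℝ) : ℂ) * I
      = Real.pi * I + ((2 : ℕ) : ℂ) * (Real.arctan s * I) := by
    push_cast; ring
  rw [circleMap, hangle, exp_add, exp_pi_mul_I, exp_nat_mul, hexp, div_pow, hsqrt, cayley]
  simp only [zero_add, ofReal_one, one_mul]
  rw [pow_two, mul_div_mul_left _ _ hadd, neg_mul, one_mul, ← div_neg, neg_sub, add_comm]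

lemma image_pi_add_two_arctan :
    (fun s : ℝ => Real.pi + 2 * Real.arctan s) '' Set.univ = Set.Ioo 0 (2 * Real.pi) := by
  have h : (fun s : ℝ => Real.pi + 2 * Real.arctan s) = (Real.pi + ·) ∘ (2 * ·) ∘ Real.arctan := rfl
  rw [h, Set.image_comp, Set.image_comp, Set.image_univ, Real.range_arctan,
    Set.image_mul_left_Ioo two_pos, Set.image_const_add_Ioo]
  congr 1 <;> ring

lemma circleMap_smul_comp_pi_add_two_arctan {E : Type*} [NormedAddCommGroup E] [NormedSpace ℂ E]
    (F : ℂ → E) (s : ℝ) :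
    |2 * (1 / (1 + s ^ 2))| • deriv (circleMap 0 1) (Real.pi + 2 * Real.arctan s) •
      F (circleMap 0 1 (Real.pi + 2 * Real.arctan s)) =
      (-2 * I / (s * I - 1) ^ 2) • F (cayley (s * I)) := by
  have hsub : (s : ℂ) * I - 1 ≠ 0 := sub_ne_zero.2 (ofReal_mul_I_ne_one s)
  have hadd : (s : ℂ) * I + 1 ≠ 0 := fun h => by simpa using congrArg re h
  have hsq : (1 + s ^ 2 : ℂ) = -((s * I + 1) * (s * I - 1)) := by
    linear_combination ((s : ℂ) ^ 2) * I_sq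
  rw [deriv_circleMap, circleMap_pi_add_two_arctan, abs_of_nonneg (by positivity),
    ← Complex.coe_smul, smul_smul]
  congr 1
  push_cast
  rw [hsq, cayley]
  field_simp

lemma injective_pi_add_two_arctan :
    Function.Injective fun s : ℝ => Real.pi + 2 * Real.arctan s :=
  (add_right_injective Real.pi).comp <| (mul_right_injective₀ two_ne_zero).comp
    Real.arctan_injective

lemma hasDerivAt_pi_add_two_arctan (s : ℝ) :
    HasDerivAt (fun s : ℝ => Real.pi + 2 * Real.arctan s) (2 * (1 / (1 + s ^ 2))) s :=
  ((Real.hasDerivAt_arctan s).const_mul 2).const_add Real.pi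

lemma circleIntegrable_iff_integrable_cayley (F : ℂ → ℂ) :
    CircleIntegrable F 0 1 ↔
      Integrable fun s : ℝ => (-2 * I / (s * I - 1) ^ 2) • F (cayley (s * I)) := by
  simp only [← circleMap_smul_comp_pi_add_two_arctan F]
  rw [circleIntegrable_iff 1,
    intervalIntegrable_iff_integrableOn_Ioo_of_le Real.two_pi_pos.le, ← image_pi_add_two_arctan,
    integrableOn_image_iff_integrableOn_abs_deriv_smul MeasurableSet.univ
      (fun s _ => (hasDerivAt_pi_add_two_arctan s).hasDerivWithinAt)
      injective_pi_add_two_arctan.injOn, integrableOn_univ]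

lemma circleIntegral_eq_integral_cayley {E : Type*} [NormedAddCommGroup E] [NormedSpace ℂ E]
    (F : ℂ → E) :
    ∮ w in C(0, 1), F w = ∫ s : ℝ, (-2 * I / (s * I - 1) ^ 2) • F (cayley (s * I)) := by
  simp only [← circleMap_smul_comp_pi_add_two_arctan F]
  rw [circleIntegral, intervalIntegral.integral_of_le Real.two_pi_pos.le,
    integral_Ioc_eq_integral_Ioo, ← image_pi_add_two_arctan,
    integral_image_eq_integral_abs_deriv_smul MeasurableSet.univ
      (fun s _ => (hasDerivAt_pi_add_two_arctan s).hasDerivWithinAt)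
      injective_pi_add_two_arctan.injOn, setIntegral_univ]

end Cayley

section HalfPlane

open Metric

lemma closure_re_neg : closure {z : ℂ | z.re < 0} = {z : ℂ | z.re ≤ 0} :=
  Complex.closure_setOfPred_re_lt 0

lemma tendsto_sub_const_mul_of_tendsto_mul {l : Filter ℂ} (hl : l ≤ cobounded ℂ) {g : ℂ → ℂ}
    {L : ℂ} (hg : Tendsto (fun z => z * g z) l (𝓝 L)) (c : ℂ) :
    Tendsto (fun z => (z - c) * g z) l (𝓝 L) := by
  have hzero : Tendsto g l (𝓝 0) := by
    have h := (tendsto_inv₀_cobounded.mono_left hl).mul hg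
    rw [zero_mul] at h
    refine h.congr' ?_
    filter_upwards [hl (eventually_ne_cobounded (0 : ℂ))] with z hz using inv_mul_cancel_left₀ hz _
  simpa [sub_mul] using hg.sub (hzero.const_mul c)

lemma diffContOnCl_update_cayley {g : ℂ → ℂ} {L : ℂ} (hg : DiffContOnCl ℂ g {z : ℂ | z.re < 0})
    (hL : Tendsto (fun z => z * g z) (cobounded ℂ ⊓ 𝓟 {z : ℂ | z.re ≤ 0}) (𝓝 L)) :
    DiffContOnCl ℂ (Function.update (fun w => (cayley w - 1) * g (cayley w)) 1 L) (ball 0 1) := by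
  have hcont := hg.continuousOn
  rw [closure_re_neg] at hcont
  have hball : ball (0 : ℂ) 1 ⊆ {1}ᶜ := by
    rintro w hw rfl
    simp at hw
  refine DiffContOnCl.mk_ball ?_ ?_
  · have hd := differentiableOn_cayley.mono hball
    refine ((hd.sub_const 1).mul <| hg.differentiableOn.comp hd fun w hw =>
      cayley_re_neg (by simpa using hw)).congr fun w hw => ?_
    exact Function.update_of_ne (hball hw) _ _
  · have hmaps : Set.MapsTo cayley (closedBall 0 1 \ {1}) {z : ℂ | z.re ≤ 0} := fun w hw =>
      cayley_re_nonpos (by simpa using hw.1)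
    have hc := differentiableOn_cayley.continuousOn.mono
      fun w (hw : w ∈ closedBall 0 1 \ {1}) => hw.2
    refine continuousOn_update_iff.2
      ⟨(hc.sub continuousOn_const).mul (hcont.comp hc hmaps), fun _ => ?_⟩
    refine (tendsto_sub_const_mul_of_tendsto_mul inf_le_left hL 1).comp <| tendsto_inf.2
      ⟨tendsto_cayley_cobounded.mono_left <| nhdsWithin_mono _ fun w hw => hw.2,
        tendsto_principal.2 ?_⟩
    filter_upwards [self_mem_nhdsWithin] with w hw using hmaps hw

theorem cauchy_re_neg {g : ℂ → ℂ} {L u : ℂ} (hg : DiffContOnCl ℂ g {z : ℂ | z.re < 0})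
    (hL : Tendsto (fun z => z * g z) (cobounded ℂ ⊓ 𝓟 {z : ℂ | z.re ≤ 0}) (𝓝 L))
    (hu : u.re < 0) :
    Integrable (fun s : ℝ => g (s * I) / (s * I - u)) ∧
      ∫ s : ℝ, g (s * I) / (s * I - u) = 2 * Real.pi * g u := by
  set G := Function.update (fun w => (cayley w - 1) * g (cayley w)) 1 L with hG
  have hGcayley {z : ℂ} (hz : z ≠ 1) : G (cayley z) = (z - 1) * g z := by
    rw [hG, Function.update_of_ne (cayley_ne_one z), cayley_cayley hz]
  have hdiff : DiffContOnCl ℂ G (ball 0 1) := diffContOnCl_update_cayley hg hL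
  have hu₁ : u ≠ 1 := by rintro rfl; norm_num at hu
  have hw : cayley u ∈ ball (0 : ℂ) 1 := by simpa using norm_cayley_lt_one hu
  have hpull {z : ℂ} (hz : z ≠ 1) : (-2 * I / (z - 1) ^ 2) • (cayley z - cayley u)⁻¹ •
      G (cayley z) = I * (u - 1) * (g z / (z - u)) := by
    have hz' : z - 1 ≠ 0 := sub_ne_zero.2 hz
    have hu' : u - 1 ≠ 0 := sub_ne_zero.2 hu₁
    rw [hGcayley hz, cayley_sub_cayley hz hu₁, smul_eq_mul, smul_eq_mul, inv_div]
    field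
  have hconst : I * (u - 1) ≠ 0 := mul_ne_zero I_ne_zero (sub_ne_zero.2 hu₁)
  have hcirc : ContinuousOn (fun w => (w - cayley u)⁻¹ • G w) (sphere 0 1) := by
    refine ((continuous_sub_right _).continuousOn.inv₀ fun w hw' => sub_ne_zero.2 ?_).smul
      (hdiff.continuousOn_ball.mono sphere_subset_closedBall)
    rintro rfl
    exact (mem_ball.1 hw).ne hw'
  have hint := (circleIntegrable_iff_integrable_cayley _).1 (hcirc.circleIntegrable zero_le_one)
  have hcauchy := hdiff.circleIntegral_sub_inv_smul hw
  rw [circleIntegral_eq_integral_cayley, hGcayley hu₁, smul_eq_mul] at hcauchy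
  simp_rw [hpull (ofReal_mul_I_ne_one _)] at hint hcauchy
  rw [integral_const_mul] at hcauchy
  exact ⟨(integrable_const_mul_iff (isUnit_iff_ne_zero.2 hconst) _).1 hint,
    mul_left_cancel₀ hconst (hcauchy.trans (by ring))⟩

end HalfPlane

section Hermite

open Polynomial Asymptotics Lagrange

lemma add_ne_zero_of_re_neg {u z : ℂ} (hu : u.re < 0) (hz : z.re ≤ 0) : u + z ≠ 0 := fun h => by
  have hre := congrArg re h
  rw [add_re, zero_re] at hre
  linarith

lemma tendsto_neg_cobounded_inf_re_nonpos :
    Tendsto (fun z : ℂ => -z) (cobounded ℂ ⊓ 𝓟 {z : ℂ | z.re ≤ 0})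
      (cobounded ℂ ⊓ 𝓟 {z : ℂ | 0 ≤ z.re}) :=
  tendsto_inf.2 ⟨tendsto_neg_cobounded.mono_left inf_le_left, tendsto_principal.2 <|
    eventually_inf_principal.2 <| .of_forall fun z hz => by simpa using hz⟩

-- Reflect to the left half-plane; the factor `1 - 2 u / (u + z)` compensates for the reflected
-- Cauchy kernel and vanishes at `z = u`.
lemma integral_div_sub_eq_zero_of_re_pos {h : ℂ → ℂ} {L u : ℂ}
    (hh : DiffContOnCl ℂ h {z : ℂ | 0 < z.re})
    (hL : Tendsto (fun z => z * h z) (cobounded ℂ ⊓ 𝓟 {z : ℂ | 0 ≤ z.re}) (𝓝 L)) (hu : u.re < 0) :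
    Integrable (fun s : ℝ => h (s * I) / (s * I - u)) ∧
      ∫ s : ℝ, h (s * I) / (s * I - u) = 0 := by
  have hinv : Tendsto (fun z => 1 - 2 * u * (u + z)⁻¹) (cobounded ℂ ⊓ 𝓟 {z : ℂ | z.re ≤ 0})
      (𝓝 1) := by
    simpa using ((tendsto_inv₀_cobounded.comp
      (tendsto_const_add_cobounded u)).mono_left inf_le_left).const_mul (2 * u) |>.const_sub 1
  have hdiff : DiffContOnCl ℂ (fun z => h (-z) * (1 - 2 * u * (u + z)⁻¹)) {z : ℂ | z.re < 0} := by
    refine (hh.comp differentiable_neg.diffContOnCl fun z hz => ?_).smul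
      (((Differentiable.diffContOnCl (by fun_prop)).inv fun z hz =>
        add_ne_zero_of_re_neg hu ?_).const_smul (2 * u) |>.const_sub 1)
    · simpa using hz
    · rw [closure_re_neg] at hz; exact hz
  have hlim : Tendsto (fun z => z * (h (-z) * (1 - 2 * u * (u + z)⁻¹)))
      (cobounded ℂ ⊓ 𝓟 {z : ℂ | z.re ≤ 0}) (𝓝 (-L)) := by
    simpa [mul_assoc] using (hL.comp tendsto_neg_cobounded_inf_re_nonpos).neg.mul hinv
  have hkernel (s : ℝ) : h (-(s * I)) * (1 - 2 * u * (u + s * I)⁻¹) / (s * I - u) =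
      -(h (↑(-s) * I) / (↑(-s) * I - u)) := by
    have h₁ : u + s * I ≠ 0 := add_ne_zero_of_re_neg hu (by simp)
    have h₂ : (s : ℂ) * I - u ≠ 0 := sub_ne_zero.2 fun h₀ => by simp [← h₀] at hu
    have h₃ : (-s : ℂ) * I - u = -(u + s * I) := by ring
    rw [ofReal_neg, h₃]
    field_simp
    ring_nf
  have hvanish : 1 - 2 * u * (u + u)⁻¹ = 0 := by
    rw [mul_assoc, ← mul_inv_cancel₀ (add_ne_zero_of_re_neg hu hu.le)]
    ring
  obtain ⟨hint, heq⟩ := cauchy_re_neg hdiff hlim hu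
  simp_rw [hkernel] at hint heq
  rw [integral_neg, integral_neg_eq_self (fun s : ℝ => h (s * I) / (s * I - u)), hvanish] at heq
  exact ⟨by simpa using hint.neg.comp_neg, by simpa using heq⟩

lemma exists_diffContOnCl_eq_prod_sub_mul {ι : Type*} {U : Set ℂ} (hU : IsOpen U) {s : Finset ι}
    {y : ι → ℂ} (hy : Set.InjOn y s) (hyU : ∀ i ∈ s, y i ∈ U) {f : ℂ → ℂ}
    (hf : DiffContOnCl ℂ f U) (hf₀ : ∀ i ∈ s, f (y i) = 0) :
    ∃ g : ℂ → ℂ, DiffContOnCl ℂ g U ∧ ∀ z, f z = (∏ i ∈ s, (z - y i)) * g z := by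
  classical
  induction s using Finset.induction_on generalizing f with
  | empty => exact ⟨f, hf, by simp⟩
  | insert i s hi ih =>
    have hiU : U ∈ 𝓝 (y i) := hU.mem_nhds (hyU i (by simp))
    have hfactor z : f z = (z - y i) * dslope f (y i) z := by
      simpa [hf₀ i (by simp)] using (sub_smul_dslope f (y i) z).symm
    have hdslope : DiffContOnCl ℂ (dslope f (y i)) U :=
      ⟨(Complex.differentiableOn_dslope hiU).2 hf.differentiableOn,
        (continuousOn_dslope (mem_of_superset hiU subset_closure)).2
          ⟨hf.continuousOn, hf.differentiableAt hU (hyU i (by simp))⟩⟩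
    obtain ⟨g, hg, hfg⟩ := ih (hy.mono (by simp)) (fun j hj => hyU j (by simp [hj])) hdslope
      fun j hj => by
        have h := hfactor (y j)
        rw [hf₀ j (by simp [hj]), eq_comm, mul_eq_zero, sub_eq_zero] at h
        refine h.resolve_left fun hij => hi ?_
        rwa [← hy (by simp [hj]) (by simp) hij]
    exact ⟨g, hg, fun z => by rw [Finset.prod_insert hi, hfactor z, hfg z, mul_assoc]⟩

lemma exists_tendsto_eval_div_eval_cobounded {P Q : ℂ[X]} (hQ : Q.Monic)
    (h : P.natDegree ≤ Q.natDegree) :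
    ∃ L, Tendsto (fun z => P.eval z / Q.eval z) (cobounded ℂ) (𝓝 L) := by
  have hdiv : (P /ₘ Q).natDegree = 0 := by rw [natDegree_divByMonic P hQ, Nat.sub_eq_zero_of_le h]
  have hmod := (isLittleO_cobounded_of_degree_lt (degree_modByMonic_lt P hQ)).tendsto_div_nhds_zero
  refine ⟨_, (hmod.add_const ((P /ₘ Q).coeff 0)).congr' ?_⟩
  filter_upwards [le_cofinite ℂ (eventually_cofinite_not_isRoot hQ.ne_zero)] with z hz
  have hz : Q.eval z ≠ 0 := hz
  conv_rhs => rw [← modByMonic_add_div P Q, eq_C_of_natDegree_eq_zero hdiv]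
  rw [eval_add, eval_mul, eval_C, add_div, mul_div_cancel_left₀ _ hz]

lemma eval_nodal_ne_zero_of_re_nonneg {ι : Type*} {s : Finset ι} {y : ι → ℂ}
    (hre : ∀ i ∈ s, (y i).re < 0) {z : ℂ} (hz : 0 ≤ z.re) : (nodal s y).eval z ≠ 0 := by
  rw [eval_nodal]
  refine Finset.prod_ne_zero_iff.2 fun i hi => sub_ne_zero.2 ?_
  rintro rfl
  exact (hre i hi).not_ge hz

lemma natDegree_X_mul_le_natDegree_nodal {ι : Type*} {s : Finset ι} (y : ι → ℂ) {p : ℂ[X]}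
    (hp : p.natDegree < s.card) : (X * p).natDegree ≤ (nodal s y).natDegree := by
  rw [natDegree_nodal]
  exact natDegree_mul_le.trans (by rw [natDegree_X]; omega)

lemma integral_eval_div_nodal_eq_zero {ι : Type*} {s : Finset ι} {y : ι → ℂ}
    (hre : ∀ i ∈ s, (y i).re < 0) {p : ℂ[X]} (hp : p.natDegree < s.card) {u : ℂ} (hu : u.re < 0) :
    Integrable (fun t : ℝ => p.eval (t * I) / (nodal s y).eval (t * I) / (t * I - u)) ∧
      ∫ t : ℝ, p.eval (t * I) / (nodal s y).eval (t * I) / (t * I - u) = 0 := by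
  obtain ⟨L, hL⟩ := exists_tendsto_eval_div_eval_cobounded nodal_monic
    (natDegree_X_mul_le_natDegree_nodal y hp)
  refine integral_div_sub_eq_zero_of_re_pos (h := fun z => p.eval z / (nodal s y).eval z) (L := L)
    ?_ ((hL.mono_left inf_le_left).congr fun z => ?_) hu
  · simp only [div_eq_mul_inv]
    refine p.differentiable.diffContOnCl.smul ((nodal s y).differentiable.diffContOnCl.inv
      fun z hz => eval_nodal_ne_zero_of_re_nonneg hre ?_)
    rwa [Complex.closure_setOfPred_lt_re] at hz
  · rw [eval_mul, eval_X, mul_div_assoc]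

lemma exists_tendsto_mul_of_sub_eval_eq_nodal_mul {ι : Type*} {s : Finset ι} {y : ι → ℂ}
    {l : Filter ℂ} (hl : l ≤ cobounded ℂ) {f g : ℂ → ℂ} {r : ℂ[X]}
    (hfr : f =O[l] fun z => r.eval z) (hr : r.natDegree + 1 < s.card) {p : ℂ[X]}
    (hp : p.natDegree < s.card) (hg : ∀ z, f z - p.eval z = (nodal s y).eval z * g z) :
    ∃ L, Tendsto (fun z => z * g z) l (𝓝 L) := by
  obtain ⟨L, hL⟩ := exists_tendsto_eval_div_eval_cobounded nodal_monic
    (natDegree_X_mul_le_natDegree_nodal y hp)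
  have hdeg : (X * r).degree < (nodal s y).degree :=
    degree_lt_degree <| natDegree_mul_le.trans_lt <| by rw [natDegree_X, natDegree_nodal]; omega
  have hXf : (fun z => z * f z) =O[l] fun z => (X * r).eval z := by
    simpa only [eval_mul, eval_X] using (isBigO_refl (fun z : ℂ => z) l).mul hfr
  have hf := (hXf.trans_isLittleO
    ((isLittleO_cobounded_of_degree_lt hdeg).mono hl)).tendsto_div_nhds_zero
  refine ⟨_, (hf.sub (hL.mono_left hl)).congr' ?_⟩
  filter_upwards [(hl.trans (le_cofinite ℂ))
    (eventually_cofinite_not_isRoot (nodal_ne_zero (s := s) (v := y)))] with z hz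
  have hz : (nodal s y).eval z ≠ 0 := hz
  rw [eval_mul, eval_X, ← sub_div, ← mul_sub, hg]
  field_simp

theorem hermite_remainder_re_neg {ι : Type*} {s : Finset ι} {y : ι → ℂ} (hy : Set.InjOn y s)
    (hre : ∀ i ∈ s, (y i).re < 0) {f : ℂ → ℂ} (hf : DiffContOnCl ℂ f {z : ℂ | z.re < 0})
    {r : ℂ[X]} (hfr : f =O[cobounded ℂ ⊓ 𝓟 {z : ℂ | z.re ≤ 0}] fun z => r.eval z)
    (hr : r.natDegree + 1 < s.card) {p : ℂ[X]} (hp : p.natDegree < s.card)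
    (hpf : ∀ i ∈ s, p.eval (y i) = f (y i)) {u : ℂ} (hu : u.re < 0) :
    Integrable (fun t : ℝ => f (t * I) / (nodal s y).eval (t * I) / (t * I - u)) ∧
      f u = p.eval u + (nodal s y).eval u *
        (1 / (2 * Real.pi) * ∫ t : ℝ, f (t * I) / (nodal s y).eval (t * I) / (t * I - u)) := by
  obtain ⟨g, hgd, hg⟩ := exists_diffContOnCl_eq_prod_sub_mul
    (isOpen_lt continuous_re continuous_const) hy hre (hf.sub p.differentiable.diffContOnCl)
    fun i hi => sub_eq_zero.2 (hpf i hi).symm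
  replace hg (z : ℂ) : f z - p.eval z = (nodal s y).eval z * g z := by
    rw [eval_nodal]; exact hg z
  obtain ⟨L, hL⟩ := exists_tendsto_mul_of_sub_eval_eq_nodal_mul inf_le_left hfr hr hp hg
  obtain ⟨hgint, hcauchy⟩ := cauchy_re_neg hgd hL hu
  obtain ⟨hpint, hpzero⟩ := integral_eval_div_nodal_eq_zero hre hp hu
  have hsplit (t : ℝ) : f (t * I) / (nodal s y).eval (t * I) / (t * I - u) =
      g (t * I) / (t * I - u) + p.eval (t * I) / (nodal s y).eval (t * I) / (t * I - u) := by
    have hω : (nodal s y).eval (t * I) ≠ 0 := eval_nodal_ne_zero_of_re_nonneg hre (by simp)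
    rw [← add_div, eq_add_of_sub_eq (hg _)]
    field_simp
  simp_rw [hsplit]
  refine ⟨hgint.add hpint, ?_⟩
  rw [integral_add hgint hpint, hcauchy, hpzero, add_zero, ← sub_eq_iff_eq_add', hg]
  field_simp

end Hermite

namespace QSeries

section QPochhammer

variable (a : ℂ) {q : ℂ}

lemma qPoch_succ (q : ℂ) (n : ℕ) : qPoch a q (n + 1) = qPoch a q n * (1 - a * q ^ n) :=
  Finset.prod_range_succ _ n

lemma qPoch_succ' (q : ℂ) (n : ℕ) : qPoch a q (n + 1) = (1 - a) * qPoch (a * q) q n := by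
  simp only [qPoch, Finset.prod_range_succ', pow_zero, mul_one, mul_comm (1 - a), pow_succ',
    mul_assoc]

lemma tendsto_qPoch (hq : ‖q‖ < 1) : Tendsto (fun n => qPoch a q n) atTop (𝓝 (qPochInf a q)) :=
  (multipliable_qPochInf a hq).tendsto_prod_tprod_nat

lemma qPochInf_eq_one_sub_mul (hq : ‖q‖ < 1) :
    qPochInf a q = (1 - a) * qPochInf (a * q) q := by
  refine tendsto_nhds_unique ((tendsto_qPoch a hq).comp (tendsto_add_atTop_nat 1)) ?_
  simpa only [Function.comp_def, qPoch_succ'] using (tendsto_qPoch (a * q) hq).const_mul (1 - a)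

lemma summable_norm_neg_mul_pow (hq : ‖q‖ < 1) : Summable fun j : ℕ => ‖-(a * q ^ j)‖ := by
  simpa only [norm_neg, norm_mul, norm_pow] using
    (summable_geometric_of_lt_one (norm_nonneg q) hq).mul_left ‖a‖

variable {a}

lemma qPochInf_ne_zero_iff (hq : ‖q‖ < 1) : qPochInf a q ≠ 0 ↔ ∀ j : ℕ, a * q ^ j ≠ 1 := by
  refine ⟨fun h j hj => h ?_, fun h => ?_⟩
  · exact tprod_of_exists_eq_zero ⟨j, by rw [hj, sub_self]⟩
  · simpa only [qPochInf, sub_eq_add_neg] using tprod_one_add_ne_zero_of_summable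
      (fun j => by rw [← sub_eq_add_neg]; exact sub_ne_zero.2 (h j).symm)
      (summable_norm_neg_mul_pow a hq)

lemma qPoch_ne_zero (hq : ‖q‖ < 1) (h : qPochInf a q ≠ 0) (n : ℕ) : qPoch a q n ≠ 0 :=
  Finset.prod_ne_zero_iff.2 fun j _ => sub_ne_zero.2 ((qPochInf_ne_zero_iff hq).1 h j).symm

lemma one_sub_mul_pow_ne_zero (hq : ‖q‖ < 1) (ha : qPochInf a q ≠ 0) (n : ℕ) :
    1 - a * q ^ n ≠ 0 :=
  sub_ne_zero.2 ((qPochInf_ne_zero_iff hq).1 ha n).symm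

lemma qPochInf_mul_base_ne_zero (hq : ‖q‖ < 1) (ha : qPochInf a q ≠ 0) :
    qPochInf (a * q) q ≠ 0 :=
  right_ne_zero_of_mul (qPochInf_eq_one_sub_mul a hq ▸ ha)

lemma one_sub_mul_pow_div_qPoch (hq : ‖q‖ < 1) (ha : qPochInf a q ≠ 0) (n : ℕ) :
    (1 - a * q ^ n) / qPoch (a * q) q n = (1 - a) / qPoch a q n := by
  rw [div_eq_div_iff (qPoch_ne_zero hq (qPochInf_mul_base_ne_zero hq ha) n) (qPoch_ne_zero hq ha n),
    mul_comm, ← qPoch_succ, qPoch_succ']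

lemma qPochInf_self_ne_zero (hq : ‖q‖ < 1) : qPochInf q q ≠ 0 := by
  refine (qPochInf_ne_zero_iff hq).2 fun j hj => ?_
  rw [← pow_succ'] at hj
  exact (pow_lt_one₀ (norm_nonneg q) hq j.succ_ne_zero).ne (by rw [← norm_pow, hj, norm_one])

lemma differentiable_qPochInf (hq : ‖q‖ < 1) : Differentiable ℂ fun a => qPochInf a q := by
  simp only [qPochInf, sub_eq_add_neg]
  refine differentiable_tprod_one_add (fun j => by fun_prop) fun R =>
    ⟨_, (summable_geometric_of_lt_one (norm_nonneg q) hq).mul_left R, fun j z hz => ?_⟩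
  rw [norm_neg, norm_mul, norm_pow]
  gcongr

lemma eventually_qPochInf_sq_ne_zero (hq : ‖q‖ < 1) (a : ℂ) :
    ∀ᶠ x in 𝓝[≠] a, qPochInf (x ^ 2) q ≠ 0 := by
  have hanalytic : AnalyticOnNhd ℂ (fun x => qPochInf (x ^ 2) q) Set.univ := fun x _ =>
    ((differentiable_qPochInf hq).comp (differentiable_pow 2)).analyticAt x
  by_contra h
  have hzero := hanalytic.eqOn_zero_of_preconnected_of_frequently_eq_zero isPreconnected_univ
    (Set.mem_univ a) h (Set.mem_univ 0)
  exact (qPochInf_ne_zero_iff hq).2 (fun j => by simp) hzero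

lemma summable_phi32Term {a b c d e z : ℂ} (hq : ‖q‖ < 1) (hz : ‖z‖ < 1)
    (hd : qPochInf d q ≠ 0) (he : qPochInf e q ≠ 0) :
    Summable (phi32Term a b c d e q z) := by
  have hcoeff : Tendsto (fun k => (qPoch a q k * qPoch b q k * qPoch c q k) /
      (qPoch q q k * qPoch d q k * qPoch e q k)) atTop
      (𝓝 ((qPochInf a q * qPochInf b q * qPochInf c q) /
        (qPochInf q q * qPochInf d q * qPochInf e q))) :=
    (((tendsto_qPoch a hq).mul (tendsto_qPoch b hq)).mul (tendsto_qPoch c hq)).div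
      (((tendsto_qPoch q hq).mul (tendsto_qPoch d hq)).mul (tendsto_qPoch e hq))
      (mul_ne_zero (mul_ne_zero (qPochInf_self_ne_zero hq) hd) he)
  have hbound : phi32Term a b c d e q z =O[atTop] fun k : ℕ => 1 * ‖z‖ ^ k :=
    (hcoeff.isBigO_one ℝ).mul (Asymptotics.isBigO_of_le atTop fun k => by simp)
  simp only [one_mul] at hbound
  exact summable_of_isBigO_nat (summable_geometric_of_lt_one (norm_nonneg z) hz) hbound

end QPochhammer

section Joukowski

/-- The Joukowski map `v ↦ v + 1/v`. Every product `(a v, a/v; q)_n` is a function of it. -/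
noncomputable def joukowski (v : ℂ) : ℂ := v + v⁻¹

lemma joukowski_re (v : ℂ) : (joukowski v).re = v.re * (1 + (normSq v)⁻¹) := by
  rw [joukowski, add_re, inv_re]
  ring

lemma joukowski_re_neg {v : ℂ} (hv : v.re < 0) : (joukowski v).re < 0 := by
  rw [joukowski_re]
  exact mul_neg_of_neg_of_pos hv
    (add_pos_of_pos_of_nonneg one_pos (inv_nonneg.2 (normSq_nonneg v)))

lemma joukowski_eq_joukowski {a b : ℂ} (ha : a ≠ 0) (hb : b ≠ 0)
    (h : joukowski a = joukowski b) : a = b ∨ a * b = 1 := by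
  have hprod : (a - b) * (a * b - 1) = 0 := by
    rw [joukowski, joukowski] at h
    field_simp at h
    linear_combination h
  simpa only [mul_eq_zero, sub_eq_zero] using hprod

lemma one_add_sq_sub_mul_joukowski {a v : ℂ} (hv : v ≠ 0) :
    1 + a ^ 2 - a * joukowski v = (1 - a * v) * (1 - a / v) := by
  rw [joukowski]
  field_simp
  ring

end Joukowski

section Basis

open Polynomial

/-- The Askey–Wilson basis polynomial of degree `n`, normalized so that its value at
`x = v + 1/v` is `(a v, a/v; q)_n`. -/
noncomputable def askeyWilsonBasis (q a : ℂ) (n : ℕ) : ℂ[X] :=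
  ∏ j ∈ Finset.range n, (C (1 + (a * q ^ j) ^ 2) - C (a * q ^ j) * X)

/-- The entire function of `x = v + 1/v` whose value there is `(a v, a/v; q)_∞`. -/
noncomputable def askeyWilsonBasisInf (q a x : ℂ) : ℂ :=
  ∏' j : ℕ, (1 + (a * q ^ j) ^ 2 - a * q ^ j * x)

/-- The function of `x = v + 1/v` whose value there is
`(α v, α/v; q)_∞ / (β v, β/v; q)_∞`. -/
noncomputable def askeyWilsonQuot (q α β x : ℂ) : ℂ :=
  askeyWilsonBasisInf q α x / askeyWilsonBasisInf q β x

variable (q a x : ℂ)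

lemma eval_askeyWilsonBasis (n : ℕ) : (askeyWilsonBasis q a n).eval x =
    ∏ j ∈ Finset.range n, (1 + (a * q ^ j) ^ 2 - a * q ^ j * x) := by
  simp only [askeyWilsonBasis, eval_prod, eval_sub, eval_mul, eval_C, eval_X]

lemma askeyWilsonBasis_zero : askeyWilsonBasis q a 0 = 1 := Finset.prod_range_zero _

lemma askeyWilsonBasis_succ (n : ℕ) : askeyWilsonBasis q a (n + 1) =
    askeyWilsonBasis q a n * (C (1 + (a * q ^ n) ^ 2) - C (a * q ^ n) * X) :=
  Finset.prod_range_succ _ n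

lemma askeyWilsonBasis_add (m n : ℕ) : askeyWilsonBasis q a (m + n) =
    askeyWilsonBasis q a m * askeyWilsonBasis q (a * q ^ m) n := by
  simp only [askeyWilsonBasis, Finset.prod_range_add, pow_add, mul_assoc]

lemma natDegree_askeyWilsonBasis_le (n : ℕ) : (askeyWilsonBasis q a n).natDegree ≤ n := by
  refine (natDegree_prod_le _ _).trans <| (Finset.sum_le_card_nsmul _ _ 1 fun j _ => ?_).trans
    (by simp)
  compute_degree

lemma eval_askeyWilsonBasis_joukowski {v : ℂ} (hv : v ≠ 0) (n : ℕ) :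
    (askeyWilsonBasis q a n).eval (joukowski v) = qPoch (a * v) q n * qPoch (a / v) q n := by
  simp only [eval_askeyWilsonBasis, one_add_sq_sub_mul_joukowski hv, Finset.prod_mul_distrib, qPoch]
  congr 1 <;> exact Finset.prod_congr rfl fun j _ => by ring

lemma eval_askeyWilsonBasis_joukowski_node {q a : ℂ} {j n : ℕ} (hj : j < n) (ha : a * q ^ j ≠ 0) :
    (askeyWilsonBasis q a n).eval (joukowski (a * q ^ j)) = 0 := by
  rw [eval_askeyWilsonBasis]
  refine Finset.prod_eq_zero (Finset.mem_range.2 hj) ?_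
  rw [one_add_sq_sub_mul_joukowski ha, div_self ha, sub_self, mul_zero]

lemma exists_askeyWilsonBasis_eq_C_mul_nodal {q a : ℂ} (hq : q ≠ 0) (ha : a ≠ 0) (n : ℕ) :
    ∃ c : ℂ, c ≠ 0 ∧ askeyWilsonBasis q a n =
      C c * Lagrange.nodal (Finset.range n) fun j => joukowski (a * q ^ j) := by
  have hne (j : ℕ) : a * q ^ j ≠ 0 := mul_ne_zero ha (pow_ne_zero j hq)
  refine ⟨∏ j ∈ Finset.range n, -(a * q ^ j),
    Finset.prod_ne_zero_iff.2 fun j _ => neg_ne_zero.2 (hne j), ?_⟩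
  rw [askeyWilsonBasis, Lagrange.nodal_eq, map_prod C, ← Finset.prod_mul_distrib]
  refine Finset.prod_congr rfl fun j _ => ?_
  have hC : C (a * q ^ j) * C (a * q ^ j)⁻¹ = 1 := by rw [← C_mul, mul_inv_cancel₀ (hne j), C_1]
  simp only [joukowski, C_add, C_neg, C_pow, C_1]
  linear_combination -hC

lemma continuous_eval_askeyWilsonBasis (n : ℕ) :
    Continuous fun a => (askeyWilsonBasis q a n).eval x := by
  simp only [eval_askeyWilsonBasis]
  fun_prop

variable {q}

lemma norm_sq_sub_mul_le (hq : ‖q‖ < 1) (j : ℕ) :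
    ‖(a * q ^ j) ^ 2 - a * q ^ j * x‖ ≤ ‖a‖ * (‖a‖ + ‖x‖) * ‖q‖ ^ j := by
  have hqj : ‖q‖ ^ j ≤ 1 := pow_le_one₀ (norm_nonneg q) hq.le
  calc ‖(a * q ^ j) ^ 2 - a * q ^ j * x‖ = ‖a‖ * ‖q‖ ^ j * ‖a * q ^ j - x‖ := by
        rw [← norm_pow, ← norm_mul, ← norm_mul]; ring_nf
    _ ≤ ‖a‖ * ‖q‖ ^ j * (‖a‖ * ‖q‖ ^ j + ‖x‖) := by
        gcongr; simpa only [norm_mul, norm_pow] using norm_sub_le (a * q ^ j) x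
    _ ≤ ‖a‖ * ‖q‖ ^ j * (‖a‖ * 1 + ‖x‖) := by gcongr
    _ = ‖a‖ * (‖a‖ + ‖x‖) * ‖q‖ ^ j := by ring

lemma summable_norm_sq_sub_mul (hq : ‖q‖ < 1) :
    Summable fun j : ℕ => ‖(a * q ^ j) ^ 2 - a * q ^ j * x‖ :=
  .of_nonneg_of_le (fun _ => norm_nonneg _) (norm_sq_sub_mul_le a x hq)
    ((summable_geometric_of_lt_one (norm_nonneg q) hq).mul_left _)

lemma multipliable_askeyWilsonBasisInf (hq : ‖q‖ < 1) :
    Multipliable fun j : ℕ => 1 + (a * q ^ j) ^ 2 - a * q ^ j * x := by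
  simpa only [add_sub_assoc] using
    multipliable_one_add_of_summable (summable_norm_sq_sub_mul a x hq)

lemma tendsto_eval_askeyWilsonBasis (hq : ‖q‖ < 1) :
    Tendsto (fun n => (askeyWilsonBasis q a n).eval x) atTop (𝓝 (askeyWilsonBasisInf q a x)) := by
  simp only [eval_askeyWilsonBasis]
  exact (multipliable_askeyWilsonBasisInf a x hq).tendsto_prod_tprod_nat

lemma askeyWilsonBasisInf_eq_eval_mul (hq : ‖q‖ < 1) (m : ℕ) : askeyWilsonBasisInf q a x =
    (askeyWilsonBasis q a m).eval x * askeyWilsonBasisInf q (a * q ^ m) x := by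
  refine tendsto_nhds_unique
    ((tendsto_eval_askeyWilsonBasis a x hq).comp (tendsto_add_atTop_nat m)) ?_
  simpa only [Function.comp_def, add_comm _ m, askeyWilsonBasis_add, eval_mul] using
    (tendsto_eval_askeyWilsonBasis (a * q ^ m) x hq).const_mul ((askeyWilsonBasis q a m).eval x)

lemma differentiable_askeyWilsonBasisInf (hq : ‖q‖ < 1) :
    Differentiable ℂ (askeyWilsonBasisInf q a) := by
  have hfun : askeyWilsonBasisInf q a =
      fun x => ∏' j : ℕ, (1 + ((a * q ^ j) ^ 2 - a * q ^ j * x)) := by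
    simp only [← add_sub_assoc]; rfl
  rw [hfun]
  refine differentiable_tprod_one_add (fun j => by fun_prop) fun R =>
    ⟨_, (summable_geometric_of_lt_one (norm_nonneg q) hq).mul_left (‖a‖ * (‖a‖ + R)),
      fun j x hx => (norm_sq_sub_mul_le a x hq j).trans ?_⟩
  gcongr

lemma askeyWilsonBasisInf_joukowski (hq : ‖q‖ < 1) {v : ℂ} (hv : v ≠ 0) :
    askeyWilsonBasisInf q a (joukowski v) = qPochInf (a * v) q * qPochInf (a / v) q := by
  refine tendsto_nhds_unique (tendsto_eval_askeyWilsonBasis a _ hq) ?_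
  simpa only [eval_askeyWilsonBasis_joukowski _ _ hv] using
    (tendsto_qPoch _ hq).mul (tendsto_qPoch _ hq)

end Basis

section Comparison

open Polynomial

variable {q a b : ℝ} {x : ℂ}

lemma norm_one_add_sq_sub_mul_le (hab : |a| ≤ |b|) (hbx : b * x.re ≤ 0) :
    ‖(1 + a ^ 2 - a * x : ℂ)‖ ≤ ‖(1 + b ^ 2 - b * x : ℂ)‖ := by
  have hsq : a ^ 2 ≤ b ^ 2 := sq_le_sq.2 hab
  have habx : |a * x.re| ≤ -(b * x.re) := by
    rw [← abs_of_nonpos hbx, abs_mul, abs_mul]; gcongr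
  have hre : (1 + a ^ 2 - a * x.re) ^ 2 ≤ (1 + b ^ 2 - b * x.re) ^ 2 :=
    sq_le_sq' (by linarith [le_abs_self (a * x.re), sq_nonneg a, sq_nonneg b])
      (by linarith [neg_abs_le (a * x.re)])
  have him : (a * x.im) ^ 2 ≤ (b * x.im) ^ 2 := by rw [mul_pow, mul_pow]; gcongr
  have hnorm (c : ℝ) : ‖(1 + c ^ 2 - c * x : ℂ)‖ ^ 2 =
      (1 + c ^ 2 - c * x.re) ^ 2 + (c * x.im) ^ 2 := by
    rw [Complex.sq_norm, normSq_apply]; simp [pow_two]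
  refine le_of_sq_le_sq ?_ (norm_nonneg _)
  rw [hnorm, hnorm]
  exact add_le_add hre him

lemma norm_eval_askeyWilsonBasis_le (hq : 0 ≤ q) (hab : |a| ≤ |b|) (hbx : b * x.re ≤ 0) (n : ℕ) :
    ‖(askeyWilsonBasis q a n).eval x‖ ≤ ‖(askeyWilsonBasis q b n).eval x‖ := by
  simp only [eval_askeyWilsonBasis, norm_prod]
  refine Finset.prod_le_prod (fun j _ => norm_nonneg _) fun j _ => ?_
  have hqj : 0 ≤ q ^ j := pow_nonneg hq j
  have hfactor := norm_one_add_sq_sub_mul_le (a := a * q ^ j) (b := b * q ^ j) (x := x)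
    (by rw [abs_mul, abs_mul]; gcongr)
    (by rw [mul_right_comm]; exact mul_nonpos_of_nonpos_of_nonneg hbx hqj)
  exact_mod_cast hfactor

lemma one_le_norm_eval_askeyWilsonBasis (hq : 0 ≤ q) (hbx : b * x.re ≤ 0) (n : ℕ) :
    1 ≤ ‖(askeyWilsonBasis q b n).eval x‖ := by
  have h := norm_eval_askeyWilsonBasis_le (a := 0) hq (by simp) hbx n
  rw [eval_askeyWilsonBasis] at h
  simpa using h

lemma monotone_norm_eval_askeyWilsonBasis (hq : 0 ≤ q) (hbx : b * x.re ≤ 0) :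
    Monotone fun n => ‖(askeyWilsonBasis q b n).eval x‖ := by
  refine monotone_nat_of_le_succ fun n => ?_
  have h : 1 ≤ ‖(askeyWilsonBasis q (b * q ^ n) 1).eval x‖ := by
    exact_mod_cast one_le_norm_eval_askeyWilsonBasis (b := b * q ^ n) hq
      (by rw [mul_right_comm]; exact mul_nonpos_of_nonpos_of_nonneg hbx (pow_nonneg hq n)) 1
  rw [askeyWilsonBasis_add, eval_mul, norm_mul]
  exact le_mul_of_one_le_right (norm_nonneg _) h

variable (hq₀ : 0 ≤ q) (hq₁ : q < 1)
include hq₀ hq₁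

lemma norm_ofReal_lt_one : ‖(q : ℂ)‖ < 1 := by
  rwa [norm_real, Real.norm_of_nonneg hq₀]

lemma norm_askeyWilsonBasisInf_le (hab : |a| ≤ |b|) (hbx : b * x.re ≤ 0) :
    ‖askeyWilsonBasisInf q a x‖ ≤ ‖askeyWilsonBasisInf q b x‖ :=
  have hq := norm_ofReal_lt_one hq₀ hq₁
  le_of_tendsto_of_tendsto' (tendsto_eval_askeyWilsonBasis a x hq).norm
    (tendsto_eval_askeyWilsonBasis b x hq).norm (norm_eval_askeyWilsonBasis_le hq₀ hab hbx)

lemma askeyWilsonBasisInf_ne_zero (hbx : b * x.re ≤ 0) : askeyWilsonBasisInf q b x ≠ 0 :=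
  norm_pos_iff.1 <| one_pos.trans_le <| ge_of_tendsto'
    (tendsto_eval_askeyWilsonBasis b x (norm_ofReal_lt_one hq₀ hq₁)).norm
    (one_le_norm_eval_askeyWilsonBasis hq₀ hbx)

end Comparison

section Newton

open Polynomial

variable {q α β ξ : ℂ}

/-- The coefficient of `askeyWilsonBasis q ξ k` in the Newton interpolation series of
`askeyWilsonQuot q α β` with nodes `joukowski (ξ q^k)`. -/
noncomputable def newtonCoeff (q α β ξ : ℂ) (k : ℕ) : ℂ :=
  askeyWilsonQuot q α β (joukowski ξ) * (qPoch (α / β) q k * q ^ k /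
    (qPoch q q k * qPoch (α * ξ) q k * qPoch (q * ξ / β) q k))

/-- The partial sum of degree less than `n` of the Newton interpolation series of
`askeyWilsonQuot q α β` with nodes `joukowski (ξ q^k)`. -/
noncomputable def newtonSum (q α β ξ : ℂ) (n : ℕ) : ℂ[X] :=
  ∑ k ∈ Finset.range n, C (newtonCoeff q α β ξ k) * askeyWilsonBasis q ξ k

lemma newtonSum_succ (q α β ξ : ℂ) (n : ℕ) : newtonSum q α β ξ (n + 1) =
    newtonSum q α β ξ n + C (newtonCoeff q α β ξ n) * askeyWilsonBasis q ξ n :=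
  Finset.sum_range_succ _ n

lemma newtonCoeff_zero (q α β ξ : ℂ) :
    newtonCoeff q α β ξ 0 = askeyWilsonQuot q α β (joukowski ξ) := by
  simp [newtonCoeff, qPoch]

lemma newtonCoeff_succ (q α β ξ : ℂ) (n : ℕ) : newtonCoeff q α β ξ (n + 1) =
    newtonCoeff q α β ξ n * ((1 - α / β * q ^ n) * q /
      ((1 - q * q ^ n) * (1 - α * ξ * q ^ n) * (1 - q * ξ / β * q ^ n))) := by
  simp only [newtonCoeff, qPoch_succ, pow_succ, div_eq_mul_inv, mul_inv]
  ring

lemma natDegree_newtonSum_lt {n : ℕ} (hn : n ≠ 0) : (newtonSum q α β ξ n).natDegree < n := by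
  refine Nat.lt_of_le_pred (Nat.pos_of_ne_zero hn) <| natDegree_sum_le_of_forall_le _ _ ?_
  intro k hk
  exact (natDegree_C_mul_le _ _).trans <| (natDegree_askeyWilsonBasis_le q ξ k).trans <|
    Nat.le_pred_of_lt (Finset.mem_range.1 hk)

lemma eval_newtonSum {u : ℂ} (hu : u ≠ 0) (n : ℕ) :
    (newtonSum q α β ξ n).eval (joukowski u) = askeyWilsonQuot q α β (joukowski ξ) *
      ∑ k ∈ Finset.range n, phi32Term (α / β) (ξ * u) (ξ / u) (α * ξ) (q * ξ / β) q q k := by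
  simp only [newtonSum, eval_finsetSum, eval_mul, eval_C, eval_askeyWilsonBasis_joukowski _ _ hu,
    Finset.mul_sum, newtonCoeff, phi32Term]
  exact Finset.sum_congr rfl fun k _ => by ring

lemma askeyWilsonBasisInf_joukowski_mul_base (hq : ‖q‖ < 1) (hq₀ : q ≠ 0) (hξ : ξ ≠ 0) (a : ℂ) :
    (1 - a * ξ) * askeyWilsonBasisInf q a (joukowski (ξ * q)) =
      (1 - a / (ξ * q)) * askeyWilsonBasisInf q a (joukowski ξ) := by
  rw [askeyWilsonBasisInf_joukowski _ hq (mul_ne_zero hξ hq₀),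
    askeyWilsonBasisInf_joukowski _ hq hξ, qPochInf_eq_one_sub_mul (a * ξ) hq,
    qPochInf_eq_one_sub_mul (a / (ξ * q)) hq, ← mul_assoc a, div_mul_eq_mul_div,
    mul_div_mul_right _ _ hq₀]
  ring

/-- Nondegeneracy of the parameters: the base satisfies `0 < ‖q‖ < 1`, and no denominator vanishes
in the Newton coefficients with starting point `ξ`, nor in the value `askeyWilsonQuot q α β` takes
at `joukowski ξ` (up to the removable case that `ξ / β` is a nonnegative power of `q`). -/
structure IsRegular (q α β ξ : ℂ) : Prop where
  norm_lt_one : ‖q‖ < 1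
  q_ne_zero : q ≠ 0
  β_ne_zero : β ≠ 0
  ξ_ne_zero : ξ ≠ 0
  qPochInf_α_ne_zero : qPochInf (α * ξ) q ≠ 0
  qPochInf_β_ne_zero : qPochInf (β * ξ) q ≠ 0
  qPochInf_q_ne_zero : qPochInf (q * ξ / β) q ≠ 0

namespace IsRegular

variable (h : IsRegular q α β ξ)
include h

lemma mul_base : IsRegular q α β (ξ * q) where
  norm_lt_one := h.norm_lt_one
  q_ne_zero := h.q_ne_zero
  β_ne_zero := h.β_ne_zero
  ξ_ne_zero := mul_ne_zero h.ξ_ne_zero h.q_ne_zero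
  qPochInf_α_ne_zero := by
    rw [← mul_assoc]; exact qPochInf_mul_base_ne_zero h.norm_lt_one h.qPochInf_α_ne_zero
  qPochInf_β_ne_zero := by
    rw [← mul_assoc]; exact qPochInf_mul_base_ne_zero h.norm_lt_one h.qPochInf_β_ne_zero
  qPochInf_q_ne_zero := by
    rw [← mul_assoc, ← div_mul_eq_mul_div]
    exact qPochInf_mul_base_ne_zero h.norm_lt_one h.qPochInf_q_ne_zero

lemma askeyWilsonQuot_joukowski_mul_base :
    askeyWilsonQuot q α β (joukowski (ξ * q)) * ((1 - α * ξ) * (1 - q * ξ / β)) =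
      askeyWilsonQuot q α β (joukowski ξ) * ((α - ξ * q) * (1 - β * ξ) / β) := by
  have hq := h.norm_lt_one
  have hq₀ := h.q_ne_zero
  have hβ := h.β_ne_zero
  have hξ := h.ξ_ne_zero
  have hα : 1 - α * ξ ≠ 0 := by simpa using one_sub_mul_pow_ne_zero hq h.qPochInf_α_ne_zero 0
  have hβξ : 1 - β * ξ ≠ 0 := by simpa using one_sub_mul_pow_ne_zero hq h.qPochInf_β_ne_zero 0
  have hqξ : 1 - q * ξ / β ≠ 0 := by simpa using one_sub_mul_pow_ne_zero hq h.qPochInf_q_ne_zero 0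
  have hβ' : 1 - β / (ξ * q) = -(β / (ξ * q)) * (1 - q * ξ / β) := by field
  calc askeyWilsonQuot q α β (joukowski (ξ * q)) * ((1 - α * ξ) * (1 - q * ξ / β))
      = ((1 - α / (ξ * q)) * askeyWilsonBasisInf q α (joukowski ξ) / (1 - α * ξ)) /
          ((1 - β / (ξ * q)) * askeyWilsonBasisInf q β (joukowski ξ) / (1 - β * ξ)) *
          ((1 - α * ξ) * (1 - q * ξ / β)) := by
        rw [← askeyWilsonBasisInf_joukowski_mul_base hq hq₀ hξ,
          ← askeyWilsonBasisInf_joukowski_mul_base hq hq₀ hξ, mul_div_cancel_left₀ _ hα,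
          mul_div_cancel_left₀ _ hβξ, askeyWilsonQuot]
    _ = askeyWilsonQuot q α β (joukowski ξ) * ((1 - α / (ξ * q)) * (1 - β * ξ) /
          ((1 - β / (ξ * q)) * (1 - α * ξ)) * ((1 - α * ξ) * (1 - q * ξ / β))) := by
        rw [askeyWilsonQuot, div_div_div_eq]
        generalize 1 - α / (ξ * q) = a, 1 - β / (ξ * q) = b, 1 - α * ξ = c, 1 - β * ξ = d
        ring
    _ = askeyWilsonQuot q α β (joukowski ξ) * ((α - ξ * q) * (1 - β * ξ) / β) := by
        rw [hβ']
        congr 1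
        generalize 1 - q * ξ / β = d at *
        field

lemma newtonCoeff_mul_base (n : ℕ) :
    newtonCoeff q α β (ξ * q) n * ((1 - α * ξ * q ^ n) * (1 - q * ξ / β * q ^ n)) =
      newtonCoeff q α β ξ n * ((α - ξ * q) * (1 - β * ξ) / β) := by
  rw [newtonCoeff, newtonCoeff, ← mul_assoc α, ← mul_assoc q, ← div_mul_eq_mul_div (q * ξ) β]
  calc _ = askeyWilsonQuot q α β (joukowski (ξ * q)) * (qPoch (α / β) q n * q ^ n / qPoch q q n) *
        ((1 - α * ξ * q ^ n) / qPoch (α * ξ * q) q n) *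
        ((1 - q * ξ / β * q ^ n) / qPoch (q * ξ / β * q) q n) := by ring
    _ = askeyWilsonQuot q α β (joukowski (ξ * q)) * ((1 - α * ξ) * (1 - q * ξ / β)) *
        (qPoch (α / β) q n * q ^ n /
          (qPoch q q n * qPoch (α * ξ) q n * qPoch (q * ξ / β) q n)) := by
        rw [one_sub_mul_pow_div_qPoch h.norm_lt_one h.qPochInf_α_ne_zero,
          one_sub_mul_pow_div_qPoch h.norm_lt_one h.qPochInf_q_ne_zero]
        ring
    _ = _ := by rw [h.askeyWilsonQuot_joukowski_mul_base]; ring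

lemma newtonCoeff_succ_mul (n : ℕ) :
    newtonCoeff q α β ξ (n + 1) * ((q ^ n - q⁻¹) * (1 - ξ ^ 2 * q ^ (n + 1))) =
      q ^ n * newtonCoeff q α β (ξ * q) n - newtonCoeff q α β ξ n := by
  have hq := one_sub_mul_pow_ne_zero h.norm_lt_one (qPochInf_self_ne_zero h.norm_lt_one) n
  have hα := one_sub_mul_pow_ne_zero h.norm_lt_one h.qPochInf_α_ne_zero n
  have hβ := one_sub_mul_pow_ne_zero h.norm_lt_one h.qPochInf_q_ne_zero n
  have hshift := h.newtonCoeff_mul_base n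
  have hq₀ := h.q_ne_zero
  have hβ₀ := h.β_ne_zero
  refine mul_right_cancel₀ (mul_ne_zero hα hβ) ?_
  rw [newtonCoeff_succ, pow_succ q n]
  generalize q ^ n = z at *
  have hcancel : (1 - α / β * z) * q / ((1 - q * z) * (1 - α * ξ * z) * (1 - q * ξ / β * z)) *
      (z - q⁻¹) * ((1 - α * ξ * z) * (1 - q * ξ / β * z)) = -(1 - α / β * z) := by
    rw [show z - q⁻¹ = -(1 - q * z) / q by field]
    generalize 1 - q * z = a, 1 - α * ξ * z = b, 1 - q * ξ / β * z = c at *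
    field
  have hkey : z * ((α - ξ * q) * (1 - β * ξ) / β) - (1 - α * ξ * z) * (1 - q * ξ / β * z) =
      -(1 - α / β * z) * (1 - ξ ^ 2 * (z * q)) := by field
  linear_combination newtonCoeff q α β ξ n * ((1 - ξ ^ 2 * (z * q)) * hcancel - hkey) -
    z * hshift

-- Removes the node `joukowski ξ` at the cost of a term vanishing at the remaining ones.
lemma newtonSum_succ_eq (n : ℕ) : newtonSum q α β ξ (n + 1) =
    newtonSum q α β (ξ * q) n +
      C ((q ^ n)⁻¹ * newtonCoeff q α β ξ n) * askeyWilsonBasis q (ξ * q) n := by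
  induction n with
  | zero => simp [newtonSum, askeyWilsonBasis_zero]
  | succ n ih =>
    have hq := h.q_ne_zero
    have hcoeff := h.newtonCoeff_succ_mul n
    have hlinear (x : ℂ) : (q ^ (n + 1))⁻¹ * (1 + (ξ * q ^ (n + 1)) ^ 2 - ξ * q ^ (n + 1) * x) -
        (1 + ξ ^ 2 - ξ * x) = -(q ^ n)⁻¹ * ((q ^ n - q⁻¹) * (1 - ξ ^ 2 * q ^ (n + 1))) := by
      rw [pow_succ]
      field
    have hn : (q ^ n)⁻¹ * q ^ n = 1 := inv_mul_cancel₀ (pow_ne_zero n hq)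
    rw [newtonSum_succ, ih, newtonSum_succ _ _ _ _ n, add_comm n 1, askeyWilsonBasis_add,
      add_comm 1 n, askeyWilsonBasis_succ q (ξ * q), mul_assoc ξ q, ← pow_succ']
    refine Polynomial.funext fun x => ?_
    simp only [eval_add, eval_mul, eval_C, eval_sub, eval_X, eval_askeyWilsonBasis q ξ,
      Finset.prod_range_one, pow_one, pow_zero, mul_one]
    linear_combination (askeyWilsonBasis q (ξ * q) n).eval x *
      (-newtonCoeff q α β ξ (n + 1) * hlinear x + (q ^ n)⁻¹ * hcoeff +
        newtonCoeff q α β (ξ * q) n * hn)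

lemma eval_newtonSum_node {j n : ℕ} (hj : j < n) :
    (newtonSum q α β ξ n).eval (joukowski (ξ * q ^ j)) =
      askeyWilsonQuot q α β (joukowski (ξ * q ^ j)) := by
  induction j generalizing ξ n with
  | zero =>
    rw [newtonSum, eval_finsetSum, Finset.sum_eq_single_of_mem 0 (Finset.mem_range.2 hj)]
    · simp [askeyWilsonBasis_zero, newtonCoeff_zero]
    · intro k _ hk
      rw [eval_mul, eval_askeyWilsonBasis_joukowski_node (Nat.pos_of_ne_zero hk)
        (by simpa using h.ξ_ne_zero), mul_zero]
  | succ j ih =>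
    obtain ⟨n, rfl⟩ := Nat.exists_eq_succ_of_ne_zero (Nat.ne_zero_of_lt hj)
    have hjn : j < n := Nat.succ_lt_succ_iff.1 hj
    have hne : ξ * q * q ^ j ≠ 0 :=
      mul_ne_zero h.mul_base.ξ_ne_zero (pow_ne_zero j h.q_ne_zero)
    rw [h.newtonSum_succ_eq, pow_succ', ← mul_assoc, eval_add, ih h.mul_base hjn, eval_mul,
      eval_askeyWilsonBasis_joukowski_node hjn hne, mul_zero, add_zero]

lemma continuousAt_eval_newtonSum (hf : ContinuousAt (askeyWilsonQuot q α β) (joukowski ξ))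
    (n : ℕ) (x : ℂ) :
    ContinuousAt (fun ξ => (newtonSum q α β ξ n).eval x) ξ := by
  have hjoukowski : ContinuousAt joukowski ξ := continuousAt_id.add (continuousAt_inv₀ h.ξ_ne_zero)
  have hqPoch (n : ℕ) : Continuous fun a => qPoch a q n := by unfold qPoch; fun_prop
  simp only [newtonSum, eval_finsetSum, eval_mul, eval_C, newtonCoeff]
  refine tendsto_finsetSum _ fun k _ => ?_
  refine ((hf.comp hjoukowski).mul (continuousAt_const.div ?_ ?_)).mul
    (continuous_eval_askeyWilsonBasis q x k).continuousAt
  · exact (((hqPoch k).comp (continuous_const_mul α)).const_mul _ |>.mul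
      ((hqPoch k).comp ((continuous_const_mul q).div_const β))).continuousAt
  · exact mul_ne_zero (mul_ne_zero (qPoch_ne_zero h.norm_lt_one
      (qPochInf_self_ne_zero h.norm_lt_one) k) (qPoch_ne_zero h.norm_lt_one h.qPochInf_α_ne_zero k))
      (qPoch_ne_zero h.norm_lt_one h.qPochInf_q_ne_zero k)

end IsRegular

end Newton

section Expansion

open Polynomial

variable {q α β ξ : ℝ}

lemma diffContOnCl_askeyWilsonQuot (hq₀ : 0 ≤ q) (hq₁ : q < 1) (hβ : 0 ≤ β) :
    DiffContOnCl ℂ (askeyWilsonQuot q α β) {z | z.re < 0} := by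
  have hq := norm_ofReal_lt_one hq₀ hq₁
  have hfun : askeyWilsonQuot q α β =
      askeyWilsonBasisInf q α • (askeyWilsonBasisInf q β)⁻¹ := by
    ext x; simp [askeyWilsonQuot, div_eq_mul_inv]
  rw [hfun]
  refine (differentiable_askeyWilsonBasisInf α hq).diffContOnCl.smul <|
    (differentiable_askeyWilsonBasisInf β hq).diffContOnCl.inv fun x hx => ?_
  rw [closure_re_neg] at hx
  exact askeyWilsonBasisInf_ne_zero hq₀ hq₁ (mul_nonpos_of_nonneg_of_nonpos hβ hx)

lemma exists_norm_askeyWilsonQuot_le (hq₀ : 0 ≤ q) (hq₁ : q < 1) (hβ : 0 < β) (α : ℝ) :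
    ∃ r : ℂ[X], ∀ x : ℂ, x.re ≤ 0 → ‖askeyWilsonQuot q α β x‖ ≤ ‖r.eval x‖ := by
  have hzero : Tendsto (fun m => |α * q ^ m|) atTop (𝓝 0) := by
    simpa using ((tendsto_pow_atTop_nhds_zero_of_lt_one hq₀ hq₁).const_mul α).abs
  -- As soon as `|α q^m| ≤ β`, the factors of `F_α` from the `m`-th on are dominated by `F_β`.
  obtain ⟨m, hm⟩ := (hzero.eventually_le_const hβ).exists
  refine ⟨askeyWilsonBasis q α m, fun x hx => ?_⟩
  have hβx : β * x.re ≤ 0 := mul_nonpos_of_nonneg_of_nonpos hβ.le hx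
  have hle := norm_askeyWilsonBasisInf_le hq₀ hq₁ (hm.trans (le_abs_self β)) hβx
  rw [askeyWilsonQuot, norm_div,
    div_le_iff₀ (norm_pos_iff.2 (askeyWilsonBasisInf_ne_zero hq₀ hq₁ hβx)),
    askeyWilsonBasisInf_eq_eval_mul α x (norm_ofReal_lt_one hq₀ hq₁) m, norm_mul]
  gcongr
  exact_mod_cast hle

lemma isRegular_ofReal (hq₀ : 0 < q) (hq₁ : q < 1) (hβ : 0 < β) (hξ : ξ < 0)
    (hα : qPochInf (α * ξ) q ≠ 0) : IsRegular q α β ξ where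
  norm_lt_one := norm_ofReal_lt_one hq₀.le hq₁
  q_ne_zero := ofReal_ne_zero.2 hq₀.ne'
  β_ne_zero := ofReal_ne_zero.2 hβ.ne'
  ξ_ne_zero := ofReal_ne_zero.2 hξ.ne
  qPochInf_α_ne_zero := hα
  qPochInf_β_ne_zero := (qPochInf_ne_zero_iff (norm_ofReal_lt_one hq₀.le hq₁)).2 fun j => by
    have : β * ξ * q ^ j < 0 := mul_neg_of_neg_of_pos (mul_neg_of_pos_of_neg hβ hξ) (by positivity)
    exact_mod_cast (this.trans one_pos).ne
  qPochInf_q_ne_zero := (qPochInf_ne_zero_iff (norm_ofReal_lt_one hq₀.le hq₁)).2 fun j => by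
    have : q * ξ / β * q ^ j < 0 := mul_neg_of_neg_of_pos
      (div_neg_of_neg_of_pos (mul_neg_of_pos_of_neg hq₀ hξ) hβ) (by positivity)
    exact_mod_cast (this.trans one_pos).ne

lemma injective_joukowski_node (hq₀ : 0 < q) (hq₁ : q < 1) (hξ : ξ ≠ 0)
    (hξ₂ : qPochInf (ξ ^ 2) q ≠ 0) : Function.Injective fun j : ℕ => joukowski (ξ * q ^ j) := by
  have hne (j : ℕ) : (ξ * q ^ j : ℂ) ≠ 0 := by exact_mod_cast mul_ne_zero hξ (pow_pos hq₀ j).ne'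
  intro i j hij
  rcases joukowski_eq_joukowski (hne i) (hne j) hij with h | h
  · have hpow : q ^ i = q ^ j := by exact_mod_cast mul_left_cancel₀ (ofReal_ne_zero.2 hξ) h
    exact pow_right_injective₀ hq₀ hq₁.ne hpow
  · refine absurd ?_ ((qPochInf_ne_zero_iff (norm_ofReal_lt_one hq₀.le hq₁)).1 hξ₂ (i + j))
    rw [← h]
    ring

lemma joukowski_node_re_neg (hq₀ : 0 < q) (hξ : ξ < 0) (j : ℕ) :
    (joukowski (ξ * q ^ j)).re < 0 := by
  refine joukowski_re_neg ?_
  rw [← ofReal_pow, ← ofReal_mul, ofReal_re]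
  exact mul_neg_of_neg_of_pos hξ (pow_pos hq₀ j)

lemma newton_expansion_of_qPochInf_sq_ne_zero (hq₀ : 0 < q) (hq₁ : q < 1) (hβ : 0 < β)
    (hξ : ξ < 0) (hα : qPochInf (α * ξ) q ≠ 0) (hξ₂ : qPochInf (ξ ^ 2) q ≠ 0) {r : ℂ[X]}
    (hr : ∀ x : ℂ, x.re ≤ 0 → ‖askeyWilsonQuot q α β x‖ ≤ ‖r.eval x‖) {n : ℕ}
    (hn : r.natDegree + 1 < n) {x : ℂ} (hx : x.re < 0) :
    Integrable (fun t : ℝ =>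
      askeyWilsonQuot q α β (t * I) / (t * I - x) / (askeyWilsonBasis q ξ n).eval (t * I)) ∧
    askeyWilsonQuot q α β x = (newtonSum q α β ξ n).eval x +
      (askeyWilsonBasis q ξ n).eval x * (1 / (2 * Real.pi) * ∫ t : ℝ,
        askeyWilsonQuot q α β (t * I) / (t * I - x) / (askeyWilsonBasis q ξ n).eval (t * I)) := by
  have hreg := isRegular_ofReal hq₀ hq₁ hβ hξ hα
  have hbound : askeyWilsonQuot q α β =O[cobounded ℂ ⊓ 𝓟 {z | z.re ≤ 0}] fun x => r.eval x :=
    .of_bound 1 <| eventually_inf_principal.2 <| .of_forall fun x hx => by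
      simpa only [one_mul] using hr x hx
  obtain ⟨hint, hrem⟩ := hermite_remainder_re_neg (s := Finset.range n)
    (injective_joukowski_node hq₀ hq₁ hξ.ne hξ₂).injOn
    (fun j _ => joukowski_node_re_neg hq₀ hξ j)
    (diffContOnCl_askeyWilsonQuot hq₀.le hq₁ hβ.le) hbound
    (by simpa using hn)
    (by simpa using natDegree_newtonSum_lt (Nat.ne_zero_of_lt hn))
    (fun j hj => hreg.eval_newtonSum_node (Finset.mem_range.1 hj)) hx
  obtain ⟨c, hc, hnodal⟩ := exists_askeyWilsonBasis_eq_C_mul_nodal hreg.q_ne_zero hreg.ξ_ne_zero n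
  have hintegrand (t : ℝ) : askeyWilsonQuot q α β (t * I) / (t * I - x) /
      (askeyWilsonBasis q ξ n).eval (t * I) = c⁻¹ * (askeyWilsonQuot q α β (t * I) /
        (Lagrange.nodal (Finset.range n) fun j => joukowski (ξ * q ^ j)).eval (t * I) /
        (t * I - x)) := by
    rw [hnodal, eval_mul, eval_C]
    ring
  have hcancel (w k J : ℂ) : c * w * (k * (c⁻¹ * J)) = w * (k * J) := by field_simp
  simp_rw [hintegrand, integral_const_mul]
  refine ⟨hint.const_mul _, ?_⟩
  rw [hnodal, eval_mul, eval_C, hcancel, hrem]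

lemma eventually_neg_and_qPochInf_ne_zero (hq₀ : 0 ≤ q) (hq₁ : q < 1) (hξ : ξ < 0)
    (hα : qPochInf (α * ξ) q ≠ 0) :
    ∀ᶠ a : ℝ in 𝓝[>] ξ, a < 0 ∧ qPochInf (α * a) q ≠ 0 ∧ qPochInf (a ^ 2) q ≠ 0 := by
  have hq := norm_ofReal_lt_one hq₀ hq₁
  have hcoe : Tendsto ((↑) : ℝ → ℂ) (𝓝[>] ξ) (𝓝[≠] (ξ : ℂ)) :=
    continuous_ofReal.continuousWithinAt.tendsto_nhdsWithin fun a (ha : ξ < a) => by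
      simpa using ha.ne'
  have hαcont : Continuous fun a : ℝ => qPochInf (α * a) q :=
    (differentiable_qPochInf hq).continuous.comp (by fun_prop)
  filter_upwards [nhdsWithin_le_nhds (Iio_mem_nhds hξ),
    nhdsWithin_le_nhds (hαcont.continuousAt.eventually_ne hα),
    hcoe.eventually (eventually_qPochInf_sq_ne_zero hq ξ)] with a h₁ h₂ h₃ using ⟨h₁, h₂, h₃⟩

lemma tendsto_eval_newtonSum (hq₀ : 0 < q) (hq₁ : q < 1) (hβ : 0 < β) (hξ : ξ < 0)
    (hα : qPochInf (α * ξ) q ≠ 0) (n : ℕ) (x : ℂ) :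
    Tendsto (fun a : ℝ => (newtonSum q α β a n).eval x) (𝓝 ξ)
      (𝓝 ((newtonSum q α β ξ n).eval x)) := by
  have hξre : (joukowski ξ).re < 0 := joukowski_re_neg (by simpa using hξ)
  have hcont := ((diffContOnCl_askeyWilsonQuot (α := α) hq₀.le hq₁ hβ.le).differentiableAt
    (isOpen_lt continuous_re continuous_const) hξre).continuousAt
  exact ((isRegular_ofReal hq₀ hq₁ hβ hξ hα).continuousAt_eval_newtonSum hcont n x).comp
    continuous_ofReal.continuousAt

lemma newton_expansion (hq₀ : 0 < q) (hq₁ : q < 1) (hβ : 0 < β) (hξ : ξ < 0)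
    (hα : qPochInf (α * ξ) q ≠ 0) {r : ℂ[X]}
    (hr : ∀ x : ℂ, x.re ≤ 0 → ‖askeyWilsonQuot q α β x‖ ≤ ‖r.eval x‖) {n : ℕ}
    (hn : r.natDegree + 1 < n) {x : ℂ} (hx : x.re < 0) :
    Integrable (fun t : ℝ =>
      askeyWilsonQuot q α β (t * I) / (t * I - x) / (askeyWilsonBasis q ξ n).eval (t * I)) ∧
    askeyWilsonQuot q α β x = (newtonSum q α β ξ n).eval x +
      (askeyWilsonBasis q ξ n).eval x * (1 / (2 * Real.pi) * ∫ t : ℝ,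
        askeyWilsonQuot q α β (t * I) / (t * I - x) / (askeyWilsonBasis q ξ n).eval (t * I)) := by
  have hgeneric := eventually_neg_and_qPochInf_ne_zero hq₀.le hq₁ hξ hα
  have hexp : ∀ᶠ a : ℝ in 𝓝[>] ξ, _ := hgeneric.mono fun a ⟨ha, hαa, ha₂⟩ =>
    newton_expansion_of_qPochInf_sq_ne_zero hq₀ hq₁ hβ ha hαa ha₂ hr hn hx
  obtain ⟨b, hb, hb₀, hξb⟩ := (hexp.and <| (hgeneric.mono fun _ h => h.1).and
    self_mem_nhdsWithin).exists
  have hle : ∀ᶠ a : ℝ in 𝓝[>] ξ, ∀ t : ℝ, ‖(askeyWilsonBasis q b n).eval (t * I)‖ ≤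
      ‖(askeyWilsonBasis q a n).eval (t * I)‖ := by
    filter_upwards [nhdsWithin_le_nhds (Iio_mem_nhds hξb)] with a hab t
    have hab : a < b := hab
    exact norm_eval_askeyWilsonBasis_le hq₀.le
      (by rw [abs_of_neg hb₀, abs_of_neg (hab.trans hb₀)]; exact neg_le_neg hab.le) (by simp) n
  have hlim (y : ℂ) : Tendsto (fun a : ℝ => (askeyWilsonBasis q a n).eval y) (𝓝[>] ξ)
      (𝓝 ((askeyWilsonBasis q ξ n).eval y)) :=
    ((continuous_eval_askeyWilsonBasis q y n).comp continuous_ofReal).continuousWithinAt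
  obtain ⟨hint, hintegral⟩ := tendsto_integral_div_of_norm_le hb.1
    (fun t => norm_pos_iff.1 <| one_pos.trans_le <|
      one_le_norm_eval_askeyWilsonBasis hq₀.le (by simp) n)
    (hexp.mono fun a ha => ha.1.aestronglyMeasurable) hle fun t => hlim _
  refine ⟨hint, tendsto_nhds_unique (tendsto_const_nhds.congr' (hexp.mono fun a ha => ha.2)) ?_⟩
  exact ((tendsto_eval_newtonSum hq₀ hq₁ hβ hξ hα n x).mono_left nhdsWithin_le_nhds).add
    ((hlim x).mul (hintegral.const_mul _))

lemma newton_series_expansion (hq₀ : 0 < q) (hq₁ : q < 1) (hβ : 0 < β) (hξ : ξ < 0)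
    (hα : qPochInf (α * ξ) q ≠ 0) {u : ℂ} (hu : u.re < 0) :
    Integrable (fun t : ℝ =>
      askeyWilsonQuot q α β (t * I) / (t * I - joukowski u) / askeyWilsonBasisInf q ξ (t * I)) ∧
    askeyWilsonQuot q α β (joukowski u) = askeyWilsonQuot q α β (joukowski ξ) *
        phi32 (α / β) (ξ * u) (ξ / u) (α * ξ) (q * ξ / β) q q +
      askeyWilsonBasisInf q ξ (joukowski u) * (1 / (2 * Real.pi) * ∫ t : ℝ,
        askeyWilsonQuot q α β (t * I) / (t * I - joukowski u) /
          askeyWilsonBasisInf q ξ (t * I)) := by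
  have hq := norm_ofReal_lt_one hq₀.le hq₁
  have hreg := isRegular_ofReal hq₀ hq₁ hβ hξ hα
  have hu₀ : u ≠ 0 := by rintro rfl; simp at hu
  obtain ⟨r, hr⟩ := exists_norm_askeyWilsonQuot_le hq₀.le hq₁ hβ α
  have hexp (n : ℕ) := newton_expansion hq₀ hq₁ hβ hξ hα hr (n := r.natDegree + 2 + n) (by omega)
    (joukowski_re_neg hu)
  have hle (n : ℕ) (t : ℝ) : ‖(askeyWilsonBasis q ξ (r.natDegree + 2 + 0)).eval (t * I)‖ ≤
      ‖(askeyWilsonBasis q ξ (r.natDegree + 2 + n)).eval (t * I)‖ :=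
    monotone_norm_eval_askeyWilsonBasis hq₀.le (by simp) (by omega)
  have htop : Tendsto (fun n => r.natDegree + 2 + n) atTop atTop := by
    simpa only [add_comm _ (r.natDegree + 2)] using tendsto_add_atTop_nat (r.natDegree + 2)
  have hlim (y : ℂ) := (tendsto_eval_askeyWilsonBasis (ξ : ℂ) y hq).comp htop
  have hsum : Tendsto (fun n => (newtonSum q α β ξ (r.natDegree + 2 + n)).eval (joukowski u)) atTop
      (𝓝 (askeyWilsonQuot q α β (joukowski ξ) *
        phi32 (α / β) (ξ * u) (ξ / u) (α * ξ) (q * ξ / β) q q)) := by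
    simp only [eval_newtonSum hu₀]
    exact ((summable_phi32Term hq hq hreg.qPochInf_α_ne_zero
      hreg.qPochInf_q_ne_zero).hasSum.tendsto_sum_nat.comp htop).const_mul _
  obtain ⟨hint, hintegral⟩ := tendsto_integral_div_of_norm_le (hexp 0).1
    (fun t => norm_pos_iff.1 <| one_pos.trans_le <|
      one_le_norm_eval_askeyWilsonBasis hq₀.le (by simp) _)
    (.of_forall fun n => (hexp n).1.aestronglyMeasurable) (.of_forall hle) fun t => hlim _
  exact ⟨hint, tendsto_nhds_unique (tendsto_const_nhds.congr fun n => (hexp n).2)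
    (hsum.add ((hlim (joukowski u)).mul (hintegral.const_mul _)))⟩

end Expansion

section ImaginaryAxis

variable {q u : ℂ}

lemma joukowski_ofReal_mul_I (s : ℝ) : joukowski (s * I) = (s - s⁻¹ : ℝ) * I := by
  rw [joukowski, mul_inv, inv_I]
  push_cast
  ring

lemma joukowski_kernel {v : ℂ} (hu : u ≠ 0) (hv : v ≠ 0) :
    (1 - v ^ 2) * u / ((u - v) * (u * v - 1) * v) =
      (1 - (v ^ 2)⁻¹) / (joukowski v - joukowski u) := by
  have hfactor : joukowski v - joukowski u = -((u - v) * (u * v - 1)) / (u * v) := by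
    rw [joukowski, joukowski]
    field
  rw [hfactor]
  generalize (u - v) * (u * v - 1) = w
  field

lemma remainderIntegrand_eq (hq : ‖q‖ < 1) (α β ξ : ℂ) {v : ℂ} (hu : u ≠ 0) (hv : v ≠ 0) :
    remainderIntegrand q α β ξ u v = askeyWilsonBasisInf q ξ (joukowski u) *
      ((1 - (v ^ 2)⁻¹) * (askeyWilsonQuot q α β (joukowski v) /
        (joukowski v - joukowski u) / askeyWilsonBasisInf q ξ (joukowski v))) := by
  rw [remainderIntegrand, joukowski_kernel hu hv, askeyWilsonQuot]
  simp only [askeyWilsonBasisInf_joukowski _ hq hu, askeyWilsonBasisInf_joukowski _ hq hv]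
  ring

lemma remainderIntegrand_ofReal_mul_I (hq : ‖q‖ < 1) (α β ξ : ℂ) (hu : u ≠ 0) {s : ℝ}
    (hs : s ≠ 0) : remainderIntegrand q α β ξ u (s * I) =
      askeyWilsonBasisInf q ξ (joukowski u) • (1 + (s ^ 2)⁻¹) •
        (fun t : ℝ => askeyWilsonQuot q α β (t * I) / (t * I - joukowski u) /
          askeyWilsonBasisInf q ξ (t * I)) (s - s⁻¹) := by
  have hsI : (s : ℂ) * I ≠ 0 := mul_ne_zero (ofReal_ne_zero.2 hs) I_ne_zero
  rw [remainderIntegrand_eq hq α β ξ hu hsI, joukowski_ofReal_mul_I, mul_pow, I_sq, real_smul,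
    smul_eq_mul]
  push_cast
  ring

lemma integral_remainderIntegrand {α β ξ : ℂ} (hq : ‖q‖ < 1) (hu : u ≠ 0)
    (hint : Integrable fun t : ℝ => askeyWilsonQuot q α β (t * I) / (t * I - joukowski u) /
      askeyWilsonBasisInf q ξ (t * I)) :
    IntegrableOnImagAxis (remainderIntegrand q α β ξ u) ∧
      1 / (4 * Real.pi * I) * imagAxisIntegral (remainderIntegrand q α β ξ u) =
        askeyWilsonBasisInf q ξ (joukowski u) * (1 / (2 * Real.pi) * ∫ t : ℝ,
          askeyWilsonQuot q α β (t * I) / (t * I - joukowski u) /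
            askeyWilsonBasisInf q ξ (t * I)) := by
  have hae : (fun s : ℝ => remainderIntegrand q α β ξ u (s * I)) =ᵐ[volume] _ :=
    (Measure.ae_ne volume 0).mono fun s hs => remainderIntegrand_ofReal_mul_I hq α β ξ hu hs
  refine ⟨((integrable_comp_sub_inv hint).smul (askeyWilsonBasisInf q ξ (joukowski u))).congr
    hae.symm, ?_⟩
  have hpi : (Real.pi : ℂ) ≠ 0 := ofReal_ne_zero.2 Real.pi_ne_zero
  rw [imagAxisIntegral, integral_mul_const, integral_congr_ae hae, integral_smul,
    integral_comp_sub_inv hint, real_smul, smul_eq_mul]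
  generalize (∫ _ : ℝ, _ : ℂ) = J
  push_cast
  field

end ImaginaryAxis

end QSeries

theorem mainTheorem5 (q α β ξ : ℝ) (hq0 : 0 < q) (hq1 : q < 1) (hβ : 0 < β) (hξ : ξ < 0)
    (hαξ : ∀ n : ℕ, α * ξ * q ^ n ≠ 1) (u : ℂ) (hu : u.re < 0) :
    Summable (QSeries.phi32Term (α / β) (ξ * u) (ξ / u) (α * ξ) (q * ξ / β) q q) ∧
    QSeries.IntegrableOnImagAxis (QSeries.remainderIntegrand q α β ξ u) ∧
    (QSeries.qPochInf (α * u) q * QSeries.qPochInf (α / u) q) /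
        (QSeries.qPochInf (β * u) q * QSeries.qPochInf (β / u) q) =
      (QSeries.qPochInf (α * ξ) q * QSeries.qPochInf (α / ξ) q) /
          (QSeries.qPochInf (β * ξ) q * QSeries.qPochInf (β / ξ) q) *
        QSeries.phi32 (α / β) (ξ * u) (ξ / u) (α * ξ) (q * ξ / β) q q +
      1 / (4 * Real.pi * Complex.I) *
        QSeries.imagAxisIntegral (QSeries.remainderIntegrand q α β ξ u) := by
  have hq := QSeries.norm_ofReal_lt_one hq0.le hq1
  have hα : QSeries.qPochInf (α * ξ) q ≠ 0 :=
    (QSeries.qPochInf_ne_zero_iff hq).2 fun n => by exact_mod_cast hαξ n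
  have hreg := QSeries.isRegular_ofReal hq0 hq1 hβ hξ hα
  have hu₀ : u ≠ 0 := by rintro rfl; simp at hu
  obtain ⟨hint, hexpansion⟩ := QSeries.newton_series_expansion hq0 hq1 hβ hξ hα hu
  obtain ⟨hintegrable, hremainder⟩ := QSeries.integral_remainderIntegrand hq hu₀ hint
  refine ⟨QSeries.summable_phi32Term hq hq hα hreg.qPochInf_q_ne_zero, hintegrable, ?_⟩
  rw [← hremainder] at hexpansion
  simpa only [QSeries.askeyWilsonQuot, QSeries.askeyWilsonBasisInf_joukowski _ hq hu₀,
    QSeries.askeyWilsonBasisInf_joukowski _ hq hreg.ξ_ne_zero] using hexpansion
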